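/- **Setting.** Let $\varphi=(\varphi_p)_{p\in\mathbb N}$ be an acceptable programming system (an effective enumeration of the partial computable functions $\mathbb N\rightharpoonup\mathbb N$ into which every uniformly partial computable sequence of such functions can be computably translated), and let $W_p=\mathrm{dom}(\varphi_p)$. A language is a computably enumerable set $L\subseteq\mathbb N$. A text for $L$ is a sequence $T:\mathbb N\to\mathbb N\cup\{\#\}$ with $\mathrm{content}(T):=\mathrm{ran}(T)\setminus\{\#\}=L$; $T[t]$ denotes the finite sequence $T(0),\dots,T(t-1)$. A *bounded memory states learner* $M$ is given by partial computable functions $h_M:\mathbb N\times(\mathbb N\cup\{\#\})\rightharpoonup\mathbb N\cup\{?\}$ and $s_M:\mathbb N\times(\mathbb N\cup\{\#\})\rightharpoonup\mathbb N$ with the same domain. Put $s_M^*(\epsilon)=0$, $s_M^*(\sigma x)=s_M(s_M^*(\sigma),x)$, $M(\epsilon)=\,?$ and $M(\sigma x)=h_M(s_M^*(\sigma),x)$. Its learning sequence on $T$ is $h_t=M(T[t])$, $t\in\mathbb N$, which is required to be defined for all $t$. The symbol $?$ stands for "no (new) hypothesis"; in the conditions below all hypotheses whose languages are mentioned are supposed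 to be different from $?$. * $\mathbf{Ex}$: there is $t_0$ with $W_{h_{t_0}}=\mathrm{content}(T)$ and, for all $t\ge t_0$, $h_t\ne\,?$ implies $h_t=h_{t_0}$. * $\mathbf{NU}$ (non-U-shaped): for all $r\le s\le t$, $W_{h_r}=W_{h_t}=\mathrm{content}(T)$ implies $W_{h_r}=W_{h_s}$. * $\mathbf{Dec}$ (decisive): for all $r\le s\le t$, $W_{h_r}=W_{h_t}$ implies $W_{h_r}=W_{h_s}$. * $\mathbf{WMon}$ (weakly monotonic): for all $s\le t$, $\mathrm{content}(T[t])\subseteq W_{h_s}$ implies $W_{h_s}\subseteq W_{h_t}$. * $\mathbf{Caut}$ (cautious): for all $s\le t$, not $W_{h_t}\subsetneq W_{h_s}$. * $\mathbf{Mon}$ (monotonic): for all $s\le t$, $W_{h_s}\cap\mathrm{content}(T)\subseteq W_{h_t}\cap\mathrm{content}(T)$. * $\mathbf{SMon}$ (strongly monotonic): for all $s\le t$, $W_{h_s}\subseteq W_{h_t}$. For a restriction $\delta$ from this list, $[\mathbf{Txt}\,\mathbf{BMS}_*\,\delta\,\mathbf{Ex}]$ denotes the set of all collections $\mathcal L$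 of languages for which there is a bounded memory states learner $M$ such that, for every $L\in\mathcal L$ and every text $T$ for $L$, the set $\{s_M^*(T[t]) : t\in\mathbb N\}$ is finite and the learning sequence of $M$ on $T$ satisfies $\delta$ and $\mathbf{Ex}$; $[\mathbf{Txt}\,\mathbf{BMS}_*\,\mathbf{Ex}]$ is the same without $\delta$. **Theorem.** 1. $[\mathbf{Txt}\,\mathbf{BMS}_*\,\mathbf{NU}\,\mathbf{Ex}]=[\mathbf{Txt}\,\mathbf{BMS}_*\,\mathbf{Ex}]$. 2. $[\mathbf{Txt}\,\mathbf{BMS}_*\,\mathbf{Dec}\,\mathbf{Ex}]=[\mathbf{Txt}\,\mathbf{BMS}_*\,\mathbf{WMon}\,\mathbf{Ex}]=[\mathbf{Txt}\,\mathbf{BMS}_*\,\mathbf{Caut}\,\mathbf{Ex}]=[\mathbf{Txt}\,\mathbf{BMS}_*\,\mathbf{Ex}]$. 3. $[\mathbf{Txt}\,\mathbf{BMS}_*\,\mathbf{Mon}\,\mathbf{Ex}]\subsetneq[\mathbf{Txt}\,\mathbf{BMS}_*\,\mathbf{Ex}]$. 4. $[\mathbf{Txt}\,\mathbf{BMS}_*\,\mathbf{SMon}\,\mathbf{Ex}]\subsetneq[\mathbf{Txt}\,\mathbf{BMS}_*\,\mathbf{Mon}\,\mathbf{Ex}]$.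 -/

import Mathlib

namespace BMSLearning

/-- An acceptable programming system: a uniformly partial computable family `φ 0, φ 1, …` of unary
partial functions into which every such family can be translated computably. -/
structure IsAcceptable (φ : ℕ → ℕ →. ℕ) : Prop where
  partrec : Partrec₂ φ
  translate : ∀ ψ : ℕ → ℕ →. ℕ, Partrec₂ ψ →
    ∃ f : ℕ → ℕ, Computable f ∧ ∀ p x, φ (f p) x = ψ p x

/-- `W φ p` is the domain of `φ p`. -/
def W (φ : ℕ → ℕ →. ℕ) (p : ℕ) : Set ℕ := (φ p).Dom

/-- The input alphabet `ℕ ∪ {#}`; the pause symbol `#` is `none`. -/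
abbrev Datum : Type := Option ℕ

/-- The output alphabet `ℕ ∪ {?}`; the symbol `?` is `none`. -/
abbrev Hyp : Type := Option ℕ

/-- The content of an infinite sequence. -/
def content (T : ℕ → Datum) : Set ℕ := {n | ∃ t, T t = some n}

/-- The content of a finite sequence. -/
def seqContent (σ : List Datum) : Set ℕ := {n | some n ∈ σ}

/-- `T` is a text for `L`. -/
def IsText (T : ℕ → Datum) (L : Set ℕ) : Prop := content T = L

/-- The initial segment `T[t]`, consisting of `T 0, …, T (t - 1)`. -/
def initSeg (T : ℕ → Datum) (t : ℕ) : List Datum := (List.range t).map T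

/-- The data of a bounded memory states learner: a partial computable hypothesis generating
function and a partial computable state transition function with the same domain. -/
structure BMSLearner where
  h : ℕ × Datum →. Hyp
  s : ℕ × Datum →. ℕ
  partrec_h : Partrec h
  partrec_s : Partrec s
  dom_eq : h.Dom = s.Dom

namespace BMSLearner

variable (M : BMSLearner)

/-- The state reached from the initial state `0` after reading a finite sequence. -/
def sStar (σ : List Datum) : Part ℕ :=
  σ.foldl (fun q x => q.bind fun a => M.s (a, x)) (Part.some 0)

/-- The learner as a partial function on finite sequences: on `σ` followed by `x` it outputs
`h (s* σ, x)`. On the empty sequence it outputs `?`. -/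
def hStar (σ : List Datum) : Part Hyp :=
  match σ.getLast? with
  | none => Part.some none
  | some x => (M.sStar σ.dropLast).bind fun a => M.h (a, x)

theorem sStar_nil : M.sStar [] = Part.some 0 := rfl

theorem sStar_concat (σ : List Datum) (x : Datum) :
    M.sStar (σ ++ [x]) = (M.sStar σ).bind fun a => M.s (a, x) := by
  simp [sStar]

theorem hStar_nil : M.hStar [] = Part.some none := rfl

theorem hStar_concat (σ : List Datum) (x : Datum) :
    M.hStar (σ ++ [x]) = (M.sStar σ).bind fun a => M.h (a, x) := by
  simp [hStar]

/-- `h` is the learning sequence of `M` on `T`; in particular `M` is defined on every initial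
segment of `T`. -/
def IsLearningSeq (T : ℕ → Datum) (h : ℕ → Hyp) : Prop :=
  ∀ t, M.hStar (initSeg T t) = Part.some (h t)

/-- `M` uses finitely many memory states on `T`. -/
def UsesFinitelyManyStates (T : ℕ → Datum) : Prop :=
  {q : ℕ | ∃ t, q ∈ M.sStar (initSeg T t)}.Finite

end BMSLearner

/-- A condition on a learning sequence `h` for a text `T`, given the map from indices to
languages. In the conditions below only proper hypotheses (those different from `?`) are
compared. -/
abbrev Restriction : Type := (ℕ → Set ℕ) → (ℕ → Hyp) → (ℕ → Datum) → Prop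

/-- Explanatory convergence. -/
def Ex : Restriction := fun V h T =>
  ∃ t₀ p, h t₀ = some p ∧ V p = content T ∧ ∀ t, t₀ ≤ t → h t ≠ none → h t = h t₀

/-- No restriction. -/
def NoRestriction : Restriction := fun _ _ _ => True

/-- Non-U-shaped. -/
def NU : Restriction := fun V h T =>
  ∀ r s t, r ≤ s → s ≤ t → ∀ a b c, h r = some a → h s = some b → h t = some c →
    V a = V c → V c = content T → V a = V b

/-- Decisive. -/
def Dec : Restriction := fun V h _ =>
  ∀ r s t, r ≤ s → s ≤ t → ∀ a b c, h r = some a → h s = some b → h t = some c →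
    V a = V c → V a = V b

/-- Weakly monotonic. -/
def WMon : Restriction := fun V h T =>
  ∀ s t, s ≤ t → ∀ a b, h s = some a → h t = some b →
    seqContent (initSeg T t) ⊆ V a → V a ⊆ V b

/-- Cautious. -/
def Caut : Restriction := fun V h _ =>
  ∀ s t, s ≤ t → ∀ a b, h s = some a → h t = some b → ¬ V b ⊂ V a

/-- Monotonic. -/
def Mon : Restriction := fun V h T =>
  ∀ s t, s ≤ t → ∀ a b, h s = some a → h t = some b →
    V a ∩ content T ⊆ V b ∩ content T

/-- Strongly monotonic. -/
def SMon : Restriction := fun V h _ =>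
  ∀ s t, s ≤ t → ∀ a b, h s = some a → h t = some b → V a ⊆ V b

/-- `[Txt BMS_* δ Ex]`: the collections of computably enumerable languages for which a single
bounded memory states learner, on every text for every member, uses only finitely many states,
converges explanatorily and satisfies `δ`. -/
def TxtBMSStarEx (φ : ℕ → ℕ →. ℕ) (δ : Restriction) : Set (Set (Set ℕ)) :=
  {C | (∀ L ∈ C, REPred fun n => n ∈ L) ∧
    ∃ M : BMSLearner, ∀ L ∈ C, ∀ T, IsText T L →
      M.UsesFinitelyManyStates T ∧
      ∃ h, M.IsLearningSeq T h ∧ δ (W φ) h T ∧ Ex (W φ) h T}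

end BMSLearning

/-!
Given a learner, a new one keeps only sets of mutually reachable states of the given learner, the
data that changed its memory, and a bound on the data examined so far. Since the recorded
transitions can be repeated, they can be assembled into a text for the target `L`. On this text the
given learner visits finitely many states and its conjectures converge to `L`. Hence the memory
converges as well, and in a settled memory which the pause symbol does not change, `L` is the
conjecture of each state in the set entered last.

The hypothesis attached to a memory enumerates a finite set only if each datum in the set keeps the
memory or leads to one whose hypothesis contains the set; the recursion theorem makes this circular
definition legitimate. Since no infinite sequence of changes by data for `L` starts in a settled
memory, well-founded induction shows that its hypothesis is a hypothesis for `L`. A step which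
changes the memory either enlarges the language of the hypothesis, or it stores a datum which
refutes the old hypothesis and belongs to all later ones. This implies all of `Dec`, `WMon` and
`Caut`.

For the separations: a learner conjectures the set of all even numbers after finitely many data, so
a later datum `n` which excludes the even number `n + 1` refutes strong monotonicity; if a further
datum readmits `n + 1`, then monotonicity fails too.
-/

namespace BMSLearning

open Encodable Filter

/-! ### Texts and transducers -/

section Texts

variable {L : Set ℕ}

/-- The data which may occur in a text for `L`. -/
def Legal (L : Set ℕ) (x : Datum) : Prop := ∀ n ∈ x, n ∈ L

@[simp]
theorem legal_none : Legal L none := by simp [Legal]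

@[simp]
theorem legal_some {n : ℕ} : Legal L (some n) ↔ n ∈ L := by simp [Legal]

theorem IsText.legal {T : ℕ → Datum} (hT : IsText T L) (t : ℕ) : Legal L (T t) :=
  fun _ hn => hT ▸ ⟨t, hn⟩

@[simp]
theorem length_initSeg (T : ℕ → Datum) (t : ℕ) : (initSeg T t).length = t := by simp [initSeg]

@[simp]
theorem initSeg_zero (T : ℕ → Datum) : initSeg T 0 = [] := rfl

theorem initSeg_succ (T : ℕ → Datum) (t : ℕ) : initSeg T (t + 1) = initSeg T t ++ [T t] := by
  simp [initSeg, List.range_succ]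

theorem initSeg_prefix (T : ℕ → Datum) {s t : ℕ} (h : s ≤ t) : initSeg T s <+: initSeg T t := by
  obtain ⟨d, rfl⟩ := Nat.exists_eq_add_of_le h
  simp [initSeg, List.range_add]

theorem initSeg_eq_of_prefix {T : ℕ → Datum} {w : List Datum} {t : ℕ} (h : w <+: initSeg T t) :
    initSeg T w.length = w :=
  (List.prefix_of_prefix_length_le (initSeg_prefix T (by simpa using h.length_le)) h
    (by simp)).eq_of_length (by simp)

theorem mem_content_iff {T : ℕ → Datum} {n : ℕ} : n ∈ content T ↔ ∃ t, some n ∈ initSeg T t := by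
  constructor
  · rintro ⟨t, ht⟩
    exact ⟨t + 1, by simp [initSeg_succ, ht]⟩
  · rintro ⟨t, ht⟩
    obtain ⟨s, -, hs⟩ := List.mem_map.1 ht
    exact ⟨s, hs⟩

theorem exists_text_of_chain {w : ℕ → List Datum} (hw : ∀ {m n}, m ≤ n → w m <+: w n)
    (hlen : ∀ n, n ≤ (w n).length) : ∃ T, ∀ n, initSeg T (w n).length = w n := by
  have hlt (t : ℕ) : t < (w (t + 1)).length := hlen (t + 1)
  refine ⟨fun t => (w (t + 1))[t]'(hlt t), fun n => List.ext_getElem (by simp) fun i hi hi' => ?_⟩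
  simp only [initSeg, List.getElem_map, List.getElem_range]
  rcases le_total (i + 1) n with h | h
  · exact (hw h).getElem _
  · exact ((hw h).getElem _).symm

theorem le_length_flatMap_range {α : Type*} {u : ℕ → List α} (hu : ∀ n, u n ≠ []) (n : ℕ) :
    n ≤ ((List.range n).flatMap u).length := by
  induction n with
  | zero => simp
  | succ n ih =>
    have := List.length_pos_iff.2 (hu n)
    simp only [List.range_succ, List.flatMap_append, List.flatMap_singleton, List.length_append]
    omega

theorem exists_text_of_words {w : List Datum} {u : ℕ → List Datum} (hw : ∀ x ∈ w, Legal L x)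
    (hne : ∀ n, u n ≠ []) (hlegal : ∀ n, ∀ x ∈ u n, Legal L x)
    (hcover : ∀ l ∈ L, some l ∈ w ∨ ∃ n, some l ∈ u n) :
    ∃ T, IsText T L ∧
      ∀ n, initSeg T (w ++ (List.range n).flatMap u).length = w ++ (List.range n).flatMap u := by
  have hlen (n : ℕ) : n ≤ (w ++ (List.range n).flatMap u).length :=
    (le_length_flatMap_range hne n).trans (by simp)
  have hchain {m n : ℕ} (h : m ≤ n) :
      w ++ (List.range m).flatMap u <+: w ++ (List.range n).flatMap u := by
    obtain ⟨d, rfl⟩ := Nat.exists_eq_add_of_le h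
    simp [List.range_add]
  obtain ⟨T, hT⟩ := exists_text_of_chain hchain hlen
  refine ⟨T, Set.ext fun l => mem_content_iff.trans ⟨?_, fun hl => ?_⟩, hT⟩
  · rintro ⟨t, ht⟩
    have hmem := (initSeg_prefix T (hlen t)).subset ht
    rw [hT, List.mem_append, List.mem_flatMap] at hmem
    rcases hmem with hmem | ⟨i, -, hi⟩
    · exact legal_some.1 (hw _ hmem)
    · exact legal_some.1 (hlegal i _ hi)
  · suffices ∃ n, some l ∈ w ++ (List.range n).flatMap u by
      obtain ⟨n, hn⟩ := this
      exact ⟨_, (hT n).symm ▸ hn⟩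
    rcases hcover l hl with hlw | ⟨n, hn⟩
    · exact ⟨0, by simp [hlw]⟩
    · exact ⟨n + 1, List.mem_append_right _ (List.mem_flatMap.2 ⟨n, by simp, hn⟩)⟩

open Classical in
theorem exists_text_extending (w : List Datum) (hw : ∀ x ∈ w, Legal L x) :
    ∃ T, IsText T L ∧ initSeg T w.length = w := by
  obtain ⟨T, hT, hTw⟩ := exists_text_of_words (u := fun n => [if n ∈ L then some n else none]) hw
    (by simp) (fun n => by by_cases h : n ∈ L <;> simp [h])
    (fun l hl => Or.inr ⟨l, by simp [hl]⟩)
  exact ⟨T, hT, by simpa using hTw 0⟩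

end Texts

/-- A deterministic machine reading data. Its partial transition function is given by
approximations `next k` in stages, which grow with `k`. -/
structure Transducer (σ : Type*) where
  start : σ
  next : ℕ → σ → Datum → Option σ
  next_mono : ∀ {k k' q x q'}, k ≤ k' → next k q x = some q' → next k' q x = some q'

namespace Transducer

variable {σ : Type*} (A : Transducer σ) {q q' q'' r : σ} {x : Datum} {w w' : List Datum}
  {V : σ → Set ℕ} {L : Set ℕ}

/-- On reading `x`, the transducer moves from `q` to `q'`. -/
def Step (q : σ) (x : Datum) (q' : σ) : Prop := ∃ k, A.next k q x = some q'

/-- The word `w` leads from one state to another. -/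
def Run : σ → List Datum → σ → Prop
  | q, [], q' => q = q'
  | q, x :: w, q' => ∃ r, A.Step q x r ∧ Run r w q'

/-- The state `r` is visited when the word `w` is read in state `q`. -/
def Visits (q : σ) (w : List Datum) (r : σ) : Prop := ∃ w', w' <+: w ∧ A.Run q w' r

/-- The word `w` over `L` leads from one state to another. -/
def LegalRun (L : Set ℕ) (q : σ) (w : List Datum) (q' : σ) : Prop :=
  (∀ x ∈ w, Legal L x) ∧ A.Run q w q'

/-- Some word over `L` leads from `q` to `q'`. -/
def Reaches (L : Set ℕ) (q q' : σ) : Prop := ∃ w, A.LegalRun L q w q'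

/-- The datum `x` does not lead out of the set `R` of states. -/
def Closed (R : List σ) (x : Datum) : Prop := ∀ r ∈ R, ∃ q ∈ R, A.Step r x q

/-- The sequence of states `q` is the computation on `T`. -/
def IsPath (T : ℕ → Datum) (q : ℕ → σ) : Prop :=
  q 0 = A.start ∧ ∀ t, A.Step (q t) (T t) (q (t + 1))

/-- On every text for `L`, finitely many states are visited and, if `V r` is the language
conjectured in state `r`, the conjectures eventually equal `L`. -/
def Identifies (V : σ → Set ℕ) (L : Set ℕ) : Prop :=
  ∀ T, IsText T L → ∃ q, A.IsPath T q ∧ (Set.range q).Finite ∧ ∀ᶠ t in atTop, V (q t) = L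

variable {A}

theorem Step.unique (h : A.Step q x q') (h' : A.Step q x q'') : q' = q'' := by
  obtain ⟨k, hk⟩ := h
  obtain ⟨k', hk'⟩ := h'
  exact Option.some_injective _ <| (A.next_mono (le_max_left k k') hk).symm.trans <|
    A.next_mono (le_max_right k k') hk'

@[simp]
theorem run_nil : A.Run q [] q' ↔ q = q' := Iff.rfl

@[simp]
theorem run_cons : A.Run q (x :: w) q' ↔ ∃ r, A.Step q x r ∧ A.Run r w q' := Iff.rfl

theorem run_singleton : A.Run q [x] q' ↔ A.Step q x q' := by simp

theorem run_append : A.Run q (w ++ w') q'' ↔ ∃ q', A.Run q w q' ∧ A.Run q' w' q'' := by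
  induction w generalizing q with
  | nil => simp
  | cons x w ih =>
    simp only [List.cons_append, run_cons, ih]
    exact ⟨fun ⟨r, hr, q', h, h'⟩ => ⟨q', ⟨r, hr, h⟩, h'⟩,
      fun ⟨q', ⟨r, hr, h⟩, h'⟩ => ⟨r, hr, q', h, h'⟩⟩

theorem Run.append (h : A.Run q w q') (h' : A.Run q' w' q'') : A.Run q (w ++ w') q'' :=
  run_append.2 ⟨q', h, h'⟩

theorem Run.unique (h : A.Run q w q') (h' : A.Run q w q'') : q' = q'' := by
  induction w generalizing q with
  | nil => exact h.symm.trans h'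
  | cons x w ih =>
    obtain ⟨r, hr, h⟩ := h
    obtain ⟨r', hr', h'⟩ := h'
    obtain rfl := hr.unique hr'
    exact ih h h'

theorem LegalRun.append (h : A.LegalRun L q w q') (h' : A.LegalRun L q' w' q'') :
    A.LegalRun L q (w ++ w') q'' :=
  ⟨List.forall_mem_append.2 ⟨h.1, h'.1⟩, h.2.append h'.2⟩

theorem LegalRun.nil (q : σ) : A.LegalRun L q [] q := ⟨by simp, rfl⟩

theorem Step.legalRun (h : A.Step q x q') (hx : Legal L x) : A.LegalRun L q [x] q' :=
  ⟨by simpa using hx, run_singleton.2 h⟩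

theorem Reaches.refl (q : σ) : A.Reaches L q q := ⟨[], .nil q⟩

theorem Reaches.trans (h : A.Reaches L q q') (h' : A.Reaches L q' q'') : A.Reaches L q q'' := by
  obtain ⟨w, hw⟩ := h
  obtain ⟨w', hw'⟩ := h'
  exact ⟨w ++ w', hw.append hw'⟩

theorem Step.reaches (h : A.Step q x q') (hx : Legal L x) : A.Reaches L q q' :=
  ⟨[x], h.legalRun hx⟩

theorem Visits.append_right (h : A.Visits q w r) (w' : List Datum) : A.Visits q (w ++ w') r := by
  obtain ⟨v, hv, hr⟩ := h
  exact ⟨v, hv.trans (List.prefix_append _ _), hr⟩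

theorem Run.visits_append (h : A.Run q w q') (h' : A.Visits q' w' r) : A.Visits q (w ++ w') r := by
  obtain ⟨v, hv, hr⟩ := h'
  exact ⟨w ++ v, (List.prefix_append_right_inj w).2 hv, h.append hr⟩

theorem IsPath.run_initSeg {T : ℕ → Datum} {q : ℕ → σ} (hq : A.IsPath T q) (t : ℕ) :
    A.Run A.start (initSeg T t) (q t) := by
  induction t with
  | zero => exact hq.1.symm
  | succ t ih =>
    rw [initSeg_succ]
    exact ih.append (run_singleton.2 (hq.2 t))

theorem IsPath.eq_of_run_prefix {T : ℕ → Datum} {q : ℕ → σ} (hq : A.IsPath T q) {t : ℕ}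
    (hw : w <+: initSeg T t) (h : A.Run A.start w r) : r = q w.length :=
  h.unique (by simpa only [initSeg_eq_of_prefix hw] using hq.run_initSeg w.length)

theorem Identifies.exists_run (hA : A.Identifies V L) (hw : ∀ x ∈ w, Legal L x) :
    ∃ q, A.Run A.start w q := by
  obtain ⟨T, hT, hTw⟩ := exists_text_extending w hw
  obtain ⟨q, hq, -⟩ := hA T hT
  exact ⟨q w.length, by simpa only [hTw] using hq.run_initSeg w.length⟩

theorem Identifies.exists_step (hA : A.Identifies V L) (hr : A.Reaches L A.start r)
    (hx : Legal L x) : ∃ q, A.Step r x q := by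
  obtain ⟨w, hw, hrun⟩ := hr
  obtain ⟨q, hq⟩ := hA.exists_run (w := w ++ [x])
    (List.forall_mem_append.2 ⟨hw, by simpa using hx⟩)
  obtain ⟨r', hr', hstep⟩ := run_append.1 hq
  obtain rfl := hrun.unique hr'
  exact ⟨q, run_singleton.1 hstep⟩

theorem Identifies.of_words (hA : A.Identifies V L) {u : ℕ → List Datum} {p : ℕ → σ}
    (hw : A.LegalRun L A.start w (p 0)) (hne : ∀ n, u n ≠ [])
    (hu : ∀ n, A.LegalRun L (p n) (u n) (p (n + 1)))
    (hcover : ∀ l ∈ L, some l ∈ w ∨ ∃ n, some l ∈ u n) :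
    {r | ∃ n, A.Visits (p n) (u n) r}.Finite ∧ ∀ᶠ n in atTop, V (p n) = L := by
  obtain ⟨T, hT, hTu⟩ := exists_text_of_words hw.1 hne (fun n => (hu n).1) hcover
  obtain ⟨q, hq, hfin, hconv⟩ := hA T hT
  have hrun (n : ℕ) : A.Run A.start (w ++ (List.range n).flatMap u) (p n) := by
    induction n with
    | zero => simpa using hw.2
    | succ n ih =>
      simp only [List.range_succ, List.flatMap_append, List.flatMap_singleton, ← List.append_assoc]
      exact ih.append (hu n).2
  constructor
  · refine hfin.subset ?_
    rintro r ⟨n, v, hv, hr⟩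
    refine ⟨(w ++ (List.range n).flatMap u ++ v).length, (hq.eq_of_run_prefix
      (t := (w ++ (List.range (n + 1)).flatMap u).length) ?_ ((hrun n).append hr)).symm⟩
    rw [hTu]
    simpa [List.range_succ] using hv
  · obtain ⟨t₀, ht₀⟩ := eventually_atTop.1 hconv
    filter_upwards [eventually_ge_atTop t₀] with n hn
    rw [hq.eq_of_run_prefix (t := (w ++ (List.range n).flatMap u).length) (by rw [hTu]) (hrun n)]
    refine ht₀ _ (hn.trans ((le_length_flatMap_range hne n).trans ?_))
    simp

end Transducer

/-! ### Histories -/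

section Histories

variable {σ : Type*}

/-- A finite record of a computation: sets of mutually reachable states, called components. The
first entry is the newest component, the second lists the older ones, starting with the most
recent. -/
abbrev History (σ : Type*) : Type _ := List σ × List (List σ)

namespace History

/-- All components, starting with the newest. -/
def components (h : History σ) : List (List σ) := h.1 :: h.2

/-- The states occurring in a history. -/
def states (h : History σ) : List σ := h.components.flatten

variable {h : History σ} {Rs : List (List σ)} {R : List σ} {q r : σ}

theorem mem_states : r ∈ h.states ↔ ∃ R ∈ h.components, r ∈ R := List.mem_flatten

theorem newest_mem_components (h : History σ) : h.1 ∈ h.components := List.mem_cons_self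

theorem newest_subset_states (h : History σ) : h.1 ⊆ h.states := fun _ hr =>
  mem_states.2 ⟨_, h.newest_mem_components, hr⟩

variable [DecidableEq σ]

/-- If `q` occurs in a component, the union of all components up to the first containing `q`. -/
def absorb (q : σ) : List (List σ) → Option (List σ)
  | [] => none
  | R :: Rs => if q ∈ R then some R else (absorb q Rs).map (R ++ ·)

/-- Enter the state `q`: either it closes a cycle, whose components are united, or it starts a new
component. -/
def push (h : History σ) (q : σ) : History σ := ((absorb q h.components).getD [q], h.components)

theorem forall_notMem_of_absorb_eq_none (h : absorb q Rs = none) : ∀ R ∈ Rs, q ∉ R := by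
  fun_induction absorb q Rs <;> simp_all

theorem mem_of_absorb_eq_some (h : absorb q Rs = some R) : q ∈ R := by
  fun_induction absorb q Rs generalizing R <;> grind [Option.map_eq_some_iff]

theorem absorb_subset_flatten (h : absorb q Rs = some R) : R ⊆ Rs.flatten := by
  fun_induction absorb q Rs generalizing R <;> grind [Option.map_eq_some_iff, List.flatten_cons]

theorem subset_of_absorb_cons_eq_some {R₀ : List σ} (h : absorb q (R₀ :: Rs) = some R) :
    R₀ ⊆ R := by
  grind [absorb, Option.map_eq_some_iff]

theorem components_push (h : History σ) (q : σ) :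
    (h.push q).components = (h.push q).1 :: h.components := rfl

theorem mem_newest_push (h : History σ) (q : σ) : q ∈ (h.push q).1 := by
  cases hq : absorb q h.components with
  | none => simp [push, hq]
  | some R => simpa [push, hq] using mem_of_absorb_eq_some hq

theorem eq_or_mem_states_of_mem_newest_push (hr : r ∈ (h.push q).1) : r = q ∨ r ∈ h.states := by
  cases hq : absorb q h.components with
  | none => exact Or.inl (by simpa [push, hq] using hr)
  | some R => exact Or.inr (absorb_subset_flatten hq (by simpa [push, hq] using hr))

theorem states_subset_states_push (h : History σ) (q : σ) : h.states ⊆ (h.push q).states := by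
  simp [states, components_push]

theorem newest_subset_newest_push (hq : q ∈ h.states) : h.1 ⊆ (h.push q).1 := by
  obtain ⟨R, hR, hqR⟩ := mem_states.1 hq
  cases ha : absorb q h.components with
  | none => exact absurd hqR (forall_notMem_of_absorb_eq_none ha R hR)
  | some R => simpa [push, ha] using subset_of_absorb_cons_eq_some ha

theorem eq_or_mem_states_of_mem_states_push (hr : r ∈ (h.push q).states) :
    r = q ∨ r ∈ h.states := by
  rw [states, components_push, List.flatten_cons, List.mem_append] at hr
  exact hr.elim eq_or_mem_states_of_mem_newest_push Or.inr

/-- A quantity which increases with every extension of a history. -/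
def potential (h : History σ) : Finset σ ×ₗ Finset σ := toLex (h.states.toFinset, h.1.toFinset)

theorem potential_lt_potential_push (hq : q ∉ h.1) : h.potential < (h.push q).potential := by
  have hle : h.states.toFinset ⊆ (h.push q).states.toFinset := fun r hr => by
    simpa using h.states_subset_states_push q (by simpa using hr)
  rcases hle.eq_or_ssubset with heq | hlt
  · have hqs : q ∈ h.states := by
      rw [← List.mem_toFinset, heq, List.mem_toFinset]
      exact (h.push q).newest_subset_states (h.mem_newest_push q)
    have hsub : h.1.toFinset ⊆ (h.push q).1.toFinset := fun r hr => by
      simpa using newest_subset_newest_push hqs (by simpa using hr)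
    exact Prod.Lex.toLex_lt_toLex.2 <| Or.inr ⟨heq, (Finset.ssubset_iff_of_subset hsub).2
      ⟨q, by simpa using h.mem_newest_push q, by simpa using hq⟩⟩
  · exact Prod.Lex.toLex_lt_toLex.2 (Or.inl hlt)

theorem finite_range_potential {s : ℕ → History σ}
    (hfin : {r | ∃ n, r ∈ (s n).states}.Finite) : (Set.range fun n => (s n).potential).Finite := by
  refine ((hfin.toFinset.powerset ×ˢ hfin.toFinset.powerset).finite_toSet.image toLex).subset ?_
  rintro - ⟨n, rfl⟩
  refine ⟨_, ?_, rfl⟩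
  simp only [Finset.coe_product, Finset.coe_powerset, Set.mem_prod, Set.mem_preimage,
    Set.mem_powerset_iff]
  exact ⟨fun r hr => by simpa using ⟨n, by simpa using hr⟩,
    fun r hr => by simpa using ⟨n, (s n).newest_subset_states (by simpa using hr)⟩⟩

end History

namespace Transducer

variable (A : Transducer σ) {k k' : ℕ} {h h' : History σ} {R : List σ} {q r : σ} {x : Datum}
  {xs : List Datum}

/-- All transitions from `R` on reading `x` are known in stage `k`. -/
def KnownAt (k : ℕ) (R : List σ) (x : Datum) : Prop := ∀ r ∈ R, (A.next k r x).isSome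
deriving Decidable

variable {A}

theorem KnownAt.mono (hk : k ≤ k') (h : A.KnownAt k R x) : A.KnownAt k' R x := fun r hr => by
  obtain ⟨q, hq⟩ := Option.isSome_iff_exists.1 (h r hr)
  simp [A.next_mono hk hq]

theorem exists_knownAt (h : ∀ r ∈ R, ∃ q, A.Step r x q) : ∃ k, A.KnownAt k R x := by
  induction R with
  | nil => exact ⟨0, by simp [KnownAt]⟩
  | cons r R ih =>
    obtain ⟨⟨q, k, hk⟩, hR⟩ := List.forall_mem_cons.1 h
    obtain ⟨k', hk'⟩ := ih hR
    refine ⟨max k k', List.forall_mem_cons.2 ⟨?_, hk'.mono (le_max_right k k')⟩⟩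
    simp [A.next_mono (le_max_left k k') hk]

variable [DecidableEq σ]

variable (A) in
/-- The states outside `R` which are seen in stage `k` to be entered from `R` on reading `x`. -/
def exits (k : ℕ) (R : List σ) (x : Datum) : List σ :=
  (R.filterMap fun r => A.next k r x).filter (· ∉ R)

variable (A) in
/-- The effect of `x` on a history: it enters a state outside the newest component, if there is
one. -/
def feed (k : ℕ) (h : History σ) (x : Datum) : Option (History σ) :=
  if A.KnownAt k h.1 x then some ((A.exits k h.1 x).head?.elim h h.push) else none

theorem mem_exits : q ∈ A.exits k R x ↔ q ∉ R ∧ ∃ r ∈ R, A.next k r x = some q := by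
  simp [exits, and_comm]

theorem KnownAt.exits_eq (hk : k ≤ k') (h : A.KnownAt k R x) : A.exits k' R x = A.exits k R x := by
  refine congrArg (List.filter _) (List.filterMap_congr fun r hr => ?_)
  obtain ⟨q, hq⟩ := Option.isSome_iff_exists.1 (h r hr)
  rw [hq, A.next_mono hk hq]

theorem KnownAt.exits_eq_nil_iff (h : A.KnownAt k R x) : A.exits k R x = [] ↔ A.Closed R x := by
  simp only [List.eq_nil_iff_forall_not_mem, mem_exits, not_and, not_exists]
  constructor
  · intro hR r hr
    obtain ⟨q, hq⟩ := Option.isSome_iff_exists.1 (h r hr)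
    exact ⟨q, by_contra fun hqR => hR q hqR r hr hq, k, hq⟩
  · intro hR q hqR r hr hq
    obtain ⟨q', hq', hstep⟩ := hR r hr
    exact hqR (hstep.unique ⟨k, hq⟩ ▸ hq')

theorem feed_mono (hk : k ≤ k') (hf : A.feed k h x = some h') : A.feed k' h x = some h' := by
  rw [feed, Option.ite_none_right_eq_some] at hf ⊢
  exact ⟨hf.1.mono hk, by rw [hf.1.exits_eq hk, hf.2]⟩

theorem feed_eq_some (hf : A.feed k h x = some h') :
    (h' = h ∧ A.Closed h.1 x) ∨ ∃ r ∈ h.1, ∃ q ∉ h.1, A.Step r x q ∧ h' = h.push q := by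
  rw [feed, Option.ite_none_right_eq_some, Option.some_inj] at hf
  obtain ⟨hknown, rfl⟩ := hf
  cases hexits : A.exits k h.1 x with
  | nil => exact Or.inl ⟨rfl, hknown.exits_eq_nil_iff.1 hexits⟩
  | cons q l =>
    obtain ⟨hq, r, hr, hstep⟩ := mem_exits.1 (hexits ▸ List.mem_cons_self : q ∈ A.exits k h.1 x)
    exact Or.inr ⟨r, hr, q, hq, ⟨k, hstep⟩, rfl⟩

theorem exists_feed (h : History σ) (hstep : ∀ r ∈ h.1, ∃ q, A.Step r x q) :
    ∃ k h', A.feed k h x = some h' := by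
  obtain ⟨k, hk⟩ := exists_knownAt hstep
  exact ⟨k, _, if_pos hk⟩

theorem feed_eq_or_potential_lt (hf : A.feed k h x = some h') :
    h' = h ∧ A.Closed h.1 x ∨ ¬ A.Closed h.1 x ∧ h.potential < h'.potential := by
  obtain h | ⟨r, hr, q, hq, hstep, rfl⟩ := feed_eq_some hf
  · exact Or.inl h
  · refine Or.inr ⟨fun hclosed => ?_, History.potential_lt_potential_push hq⟩
    obtain ⟨q', hq', hstep'⟩ := hclosed r hr
    exact hq (hstep.unique hstep' ▸ hq')

theorem feed_eq_self_iff (hf : A.feed k h x = some h') : h' = h ↔ A.Closed h.1 x := by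
  obtain ⟨rfl, hc⟩ | ⟨hc, hlt⟩ := feed_eq_or_potential_lt hf
  · simp [hc]
  · exact iff_of_false (by rintro rfl; exact hlt.false) hc

theorem feedAll_mono (hk : k ≤ k') (hf : xs.foldlM (A.feed k) h = some h') :
    xs.foldlM (A.feed k') h = some h' := by
  induction xs generalizing h with
  | nil => exact hf
  | cons x xs ih =>
    simp only [List.foldlM_cons, Option.bind_eq_bind, Option.bind_eq_some_iff] at hf ⊢
    obtain ⟨h₁, hf, hfs⟩ := hf
    exact ⟨h₁, feed_mono hk hf, ih hfs⟩

theorem feedAll_eq_or_potential_lt (hf : xs.foldlM (A.feed k) h = some h') :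
    (h' = h ∧ ∀ x ∈ xs, A.Closed h.1 x) ∨
      (¬ ∀ x ∈ xs, A.Closed h.1 x) ∧ h.potential < h'.potential := by
  induction xs generalizing h with
  | nil => simpa using hf.symm
  | cons x xs ih =>
    simp only [List.foldlM_cons, Option.bind_eq_bind, Option.bind_eq_some_iff] at hf
    obtain ⟨h₁, hf, hfs⟩ := hf
    rw [List.forall_mem_cons]
    rcases feed_eq_or_potential_lt hf with ⟨rfl, hc⟩ | ⟨hc, hlt⟩
    · simpa [hc] using ih hfs
    · refine Or.inr ⟨fun h => hc h.1, ?_⟩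
      rcases ih hfs with ⟨rfl, -⟩ | ⟨-, hlt'⟩
      exacts [hlt, hlt.trans hlt']

theorem components_subset_of_feedAll (hf : xs.foldlM (A.feed k) h = some h') :
    h.components ⊆ h'.components := by
  induction xs generalizing h with
  | nil => cases hf; exact List.Subset.refl _
  | cons x xs ih =>
    simp only [List.foldlM_cons, Option.bind_eq_bind, Option.bind_eq_some_iff] at hf
    obtain ⟨h₁, hf, hfs⟩ := hf
    refine List.Subset.trans ?_ (ih hfs)
    obtain ⟨rfl, -⟩ | ⟨r, -, q, -, -, rfl⟩ := feed_eq_some hf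
    · exact List.Subset.refl _
    · exact List.subset_cons_self _ _

theorem feedAll_eq_self_iff (hf : xs.foldlM (A.feed k) h = some h') :
    h' = h ↔ ∀ x ∈ xs, A.Closed h.1 x := by
  obtain ⟨rfl, hc⟩ | ⟨hc, hlt⟩ := feedAll_eq_or_potential_lt hf
  · simpa using hc
  · exact iff_of_false (by rintro rfl; exact hlt.false) hc

end Transducer

end Histories

namespace Transducer

section Validity

variable {σ : Type*} {A : Transducer σ} {V : σ → Set ℕ} {L : Set ℕ} {k : ℕ}
  {h h' h'' : History σ} {Rs : List (List σ)} {R : List σ} {D D' xs ys : List Datum} {x : Datum}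
  {p p' p'' q r r' : σ} {w w' : List Datum}

variable (A L) in
/-- The states of each component reach each other, and older components reach newer ones. -/
structure Connected (h : History σ) : Prop where
  nonempty : h.1 ≠ []
  inner : ∀ R ∈ h.components, ∀ r ∈ R, ∀ r' ∈ R, A.Reaches L r r'
  outer : h.components.Pairwise fun R R' => ∀ r ∈ R, ∀ r' ∈ R', A.Reaches L r' r
  reachable : ∀ r ∈ h.states, A.Reaches L A.start r

variable (A L) in
/-- The newest component is reached by words over `L` containing any prescribed data from `D` and
any prescribed data under which some component is closed. -/
def Covers (h : History σ) (D : List Datum) : Prop :=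
  ∀ B : List Datum, (∀ b ∈ B, Legal L b ∧ (b ∈ D ∨ ∃ R ∈ h.components, A.Closed R b)) →
    ∃ r ∈ h.1, ∃ w, A.LegalRun L A.start w r ∧ B ⊆ w

variable (A L) in
/-- The invariant of a history `h` which arises on data for `L`, together with stored data `D`. -/
structure Valid (h : History σ) (D : List Datum) : Prop extends A.Connected L h where
  legal : ∀ x ∈ D, Legal L x
  covers : A.Covers L h D

theorem Connected.reaches_newest (hc : A.Connected L h) (hr : r ∈ h.states) (hr' : r' ∈ h.1) :
    A.Reaches L r r' := by
  obtain ⟨R, hR, hrR⟩ := History.mem_states.1 hr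
  rcases List.mem_cons.1 hR with rfl | hR
  · exact hc.inner _ h.newest_mem_components r hrR r' hr'
  · exact (List.pairwise_cons.1 hc.outer).1 R hR r' hr' r hrR

theorem Closed.exists_run {B : List Datum} (hB : ∀ b ∈ B, A.Closed R b) (hr : r ∈ R) :
    ∃ r' ∈ R, A.Run r B r' := by
  induction B generalizing r with
  | nil => exact ⟨r, hr, rfl⟩
  | cons b B ih =>
    rw [List.forall_mem_cons] at hB
    obtain ⟨q, hq, hstep⟩ := hB.1 r hr
    obtain ⟨r', hr', hrun⟩ := ih hB.2 hq
    exact ⟨r', hr', q, hstep, hrun⟩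

theorem Valid.mono (hv : A.Valid L h D) (hD : D' ⊆ D) : A.Valid L h D' :=
  ⟨hv.toConnected, fun x hx => hv.legal x (hD hx), fun B hB =>
    hv.covers B fun b hb => ⟨(hB b hb).1, (hB b hb).2.imp_left fun hbD => hD hbD⟩⟩

theorem Valid.cons_of_closed (hv : A.Valid L h D) (hx : Legal L x)
    (hc : ∃ R ∈ h.components, A.Closed R x) : A.Valid L h (x :: D) := by
  refine ⟨hv.toConnected, List.forall_mem_cons.2 ⟨hx, hv.legal⟩, fun B hB =>
    hv.covers B fun b hb => ⟨(hB b hb).1, ?_⟩⟩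
  rcases (hB b hb).2 with hbD | hbR
  · rcases List.mem_cons.1 hbD with rfl | hbD
    exacts [Or.inr hc, Or.inl hbD]
  · exact Or.inr hbR

variable (A L) in
/-- The word `w` over `L` accounts for the passage from `h` to `h'` by the data `xs`. -/
structure Realizes (h : History σ) (xs : List Datum) (h' : History σ) (p : σ) (w : List Datum)
    (p' : σ) : Prop where
  legalRun : A.LegalRun L p w p'
  mem : p' ∈ h'.1
  subset : xs ⊆ w
  visits : ∀ r ∈ h'.states, r ∈ h.states ∨ A.Visits p w r

theorem Realizes.trans (hw : A.Realizes L h xs h' p w p') (hw' : A.Realizes L h' ys h'' p' w' p'') :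
    A.Realizes L h (xs ++ ys) h'' p (w ++ w') p'' where
  legalRun := hw.legalRun.append hw'.legalRun
  mem := hw'.mem
  subset := List.append_subset.2 ⟨List.subset_append_of_subset_left _ hw.subset,
    List.subset_append_of_subset_right _ hw'.subset⟩
  visits r hr := by
    rcases hw'.visits r hr with hr | hr
    · exact (hw.visits r hr).imp_right fun hv => hv.append_right w'
    · exact Or.inr (hw.legalRun.2.visits_append hr)

theorem Closed.exists_realizes (hc : A.Closed h.1 x) (hx : Legal L x) (hp : p ∈ h.1) :
    ∃ w q, A.Realizes L h [x] h p w q := by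
  obtain ⟨q, hq, hstep⟩ := hc p hp
  exact ⟨[x], q, hstep.legalRun hx, hq, List.Subset.refl _, fun r hr => .inl hr⟩

variable [DecidableEq σ]

theorem reaches_of_mem_absorb (hinner : ∀ R ∈ Rs, ∀ r ∈ R, ∀ r' ∈ R, A.Reaches L r r')
    (houter : Rs.Pairwise fun R R' => ∀ r ∈ R, ∀ r' ∈ R', A.Reaches L r' r)
    (ha : History.absorb q Rs = some R) (hr : r ∈ R) : A.Reaches L q r := by
  induction Rs generalizing R with
  | nil => simp [History.absorb] at ha
  | cons R₀ Rs ih =>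
    rw [History.absorb] at ha
    split_ifs at ha with hq
    · cases ha
      exact hinner R₀ List.mem_cons_self q hq r hr
    · obtain ⟨R₁, ha₁, rfl⟩ := Option.map_eq_some_iff.1 ha
      obtain ⟨hout, houter⟩ := List.pairwise_cons.1 houter
      rcases List.mem_append.1 hr with hr | hr
      · obtain ⟨R₂, hR₂, hq⟩ := List.mem_flatten.1
          (History.absorb_subset_flatten ha₁ (History.mem_of_absorb_eq_some ha₁))
        exact hout R₂ hR₂ r hr q hq
      · exact ih (fun R hR => hinner R (List.mem_cons_of_mem _ hR)) houter ha₁ hr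

theorem Connected.reaches_of_mem_newest_push (hc : A.Connected L h) (hr : r ∈ (h.push q).1) :
    A.Reaches L q r := by
  cases ha : History.absorb q h.components with
  | none =>
    obtain rfl : r = q := by simpa [History.push, ha] using hr
    exact .refl r
  | some R =>
    exact reaches_of_mem_absorb hc.inner hc.outer ha (by simpa [History.push, ha] using hr)

theorem Connected.push (hc : A.Connected L h) (hr : r ∈ h.1) (hrq : A.Reaches L r q) :
    A.Connected L (h.push q) := by
  have hold {s r' : σ} (hs : s ∈ h.states) (hr' : r' ∈ (h.push q).1) : A.Reaches L s r' :=
    ((hc.reaches_newest hs hr).trans hrq).trans (hc.reaches_of_mem_newest_push hr')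
  refine ⟨List.ne_nil_of_mem (h.mem_newest_push q), ?_, ?_, fun s hs => ?_⟩
  · refine List.forall_mem_cons.2 ⟨fun s hs s' hs' => ?_, hc.inner⟩
    rcases History.eq_or_mem_states_of_mem_newest_push hs with rfl | hs
    exacts [hc.reaches_of_mem_newest_push hs', hold hs hs']
  · exact List.pairwise_cons.2 ⟨fun R hR r' hr' s hs =>
      hold (History.mem_states.2 ⟨R, hR, hs⟩) hr', hc.outer⟩
  · rcases History.eq_or_mem_states_of_mem_states_push hs with rfl | hs
    exacts [(hc.reachable r (h.newest_subset_states hr)).trans hrq, hc.reachable s hs]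

open Classical in
theorem Covers.push (hcov : A.Covers L h D) (hc : A.Connected L h) (hx : Legal L x) (hr : r ∈ h.1)
    (hq : A.Step r x q) : A.Covers L (h.push q) (x :: D) := by
  intro B hB
  obtain ⟨r₁, hr₁, w₁, hw₁, hB₁⟩ := hcov
    (B.filter fun b => b ∈ D ∨ ∃ R ∈ h.components, A.Closed R b) fun b hb => by
      rw [List.mem_filter, decide_eq_true_eq] at hb
      exact ⟨(hB b hb.1).1, hb.2⟩
  obtain ⟨w₂, hw₂⟩ := hc.inner _ h.newest_mem_components r₁ hr₁ r hr
  obtain ⟨r₃, hr₃, hrun₃⟩ := Closed.exists_run (A := A) (R := (h.push q).1)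
    (B := B.filter fun b => A.Closed (h.push q).1 b)
    (fun b hb => by simpa using (List.mem_filter.1 hb).2) (h.mem_newest_push q)
  refine ⟨r₃, hr₃, _, ((hw₁.append hw₂).append (hq.legalRun hx)).append
    ⟨fun b hb => (hB b (List.mem_filter.1 hb).1).1, hrun₃⟩, fun b hb => ?_⟩
  have hcase : b = x ∨ (b ∈ D ∨ ∃ R ∈ h.components, A.Closed R b) ∨ A.Closed (h.push q).1 b := by
    have := (hB b hb).2
    rw [History.components_push, List.exists_mem_cons_iff, List.mem_cons] at this
    grind
  simp only [List.mem_append, List.mem_singleton]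
  rcases hcase with rfl | hbD | hbq
  · exact Or.inl (Or.inr rfl)
  · exact Or.inl (Or.inl (Or.inl (hB₁ (List.mem_filter.2 ⟨hb, decide_eq_true hbD⟩))))
  · exact Or.inr (List.mem_filter.2 ⟨hb, decide_eq_true hbq⟩)

theorem Valid.feed (hv : A.Valid L h D) (hx : Legal L x) (hf : A.feed k h x = some h') :
    A.Valid L h' (x :: D) := by
  rcases feed_eq_some hf with ⟨rfl, hc⟩ | ⟨r, hr, q, -, hq, rfl⟩
  · exact hv.cons_of_closed hx ⟨_, h'.newest_mem_components, hc⟩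
  · exact ⟨hv.push hr (hq.reaches hx), List.forall_mem_cons.2 ⟨hx, hv.legal⟩,
      hv.covers.push hv.toConnected hx hr hq⟩

theorem Connected.exists_realizes_feed (hc : A.Connected L h) (hx : Legal L x)
    (hf : A.feed k h x = some h') (hp : p ∈ h.1) : ∃ w p', A.Realizes L h [x] h' p w p' := by
  rcases feed_eq_some hf with ⟨rfl, hclosed⟩ | ⟨r, hr, q, -, hq, rfl⟩
  · obtain ⟨q, hqR, hq⟩ := hclosed p hp
    exact ⟨[x], q, hq.legalRun hx, hqR, List.Subset.refl _, fun r hr => Or.inl hr⟩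
  · obtain ⟨w, hw⟩ := hc.inner _ h.newest_mem_components p hp r hr
    have hrun := hw.append (hq.legalRun hx)
    refine ⟨w ++ [x], q, hrun, h.mem_newest_push q, List.subset_append_right _ _, fun s hs => ?_⟩
    rcases History.eq_or_mem_states_of_mem_states_push hs with rfl | hs
    exacts [Or.inr ⟨_, List.prefix_rfl, hrun.2⟩, Or.inl hs]

theorem Valid.feedAll (hv : A.Valid L h D) (hxs : ∀ x ∈ xs, Legal L x)
    (hf : xs.foldlM (A.feed k) h = some h') : A.Valid L h' (xs ++ D) := by
  induction xs generalizing h D with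
  | nil => cases hf; exact hv
  | cons x xs ih =>
    obtain ⟨h₁, hf, hfs⟩ := Option.bind_eq_some_iff.1 hf
    rw [List.forall_mem_cons] at hxs
    exact (ih (hv.feed hxs.1 hf) hxs.2 hfs).mono (by simp)

theorem Valid.exists_realizes_feedAll (hv : A.Valid L h D) (hxs : ∀ x ∈ xs, Legal L x)
    (hf : xs.foldlM (A.feed k) h = some h') (hp : p ∈ h.1) :
    ∃ w p', A.Realizes L h xs h' p w p' := by
  induction xs generalizing h D p with
  | nil =>
    cases hf
    exact ⟨[], p, .nil p, hp, List.Subset.refl _, fun r hr => Or.inl hr⟩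
  | cons x xs ih =>
    obtain ⟨h₁, hf, hfs⟩ := Option.bind_eq_some_iff.1 hf
    rw [List.forall_mem_cons] at hxs
    obtain ⟨w, p₁, hw⟩ := hv.exists_realizes_feed hxs.1 hf hp
    obtain ⟨w', p', hw'⟩ := ih (hv.feed hxs.1 hf) hxs.2 hfs hw.mem
    exact ⟨w ++ w', p', hw.trans hw'⟩

theorem Valid.exists_feed (hA : A.Identifies V L) (hv : A.Valid L h D) (hx : Legal L x) :
    ∃ k h', A.feed k h x = some h' :=
  Transducer.exists_feed h fun r hr =>
    hA.exists_step (hv.reachable r (h.newest_subset_states hr)) hx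

theorem Valid.exists_feedAll (hA : A.Identifies V L) (hv : A.Valid L h D)
    (hxs : ∀ x ∈ xs, Legal L x) : ∃ k h', xs.foldlM (A.feed k) h = some h' := by
  induction xs generalizing h D with
  | nil => exact ⟨0, h, rfl⟩
  | cons x xs ih =>
    rw [List.forall_mem_cons] at hxs
    obtain ⟨k, h₁, hf⟩ := hv.exists_feed hA hxs.1
    obtain ⟨k', h', hfs⟩ := ih (hv.feed hxs.1 hf) hxs.2
    refine ⟨max k k', h', Option.bind_eq_some_iff.2 ⟨h₁, ?_, ?_⟩⟩
    exacts [feed_mono (le_max_left k k') hf, feedAll_mono (le_max_right k k') hfs]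

end Validity

end Transducer

/-! ### Memories -/

section Memories

/-- A uniform enumeration of sets of natural numbers in stages: `seen k a n` says that `n` is
enumerated into the set attached to `a` before stage `k`. -/
structure Enumeration (α : Type*) where
  seen : ℕ → α → ℕ → Bool
  seen_mono : ∀ {k k' a n}, k ≤ k' → seen k a n → seen k' a n

/-- The set attached to `a`. -/
def Enumeration.set {α : Type*} (E : Enumeration α) (a : α) : Set ℕ := {n | ∃ k, E.seen k a n}

/-- The states of the transformed learner: a history of the given learner, a list of stored data,
and the stage up to which tolerated data are taken into account. -/
structure Memory (σ : Type*) where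
  history : History σ
  stored : List Datum
  bound : ℕ
deriving DecidableEq

namespace Transducer

variable {σ : Type*} [DecidableEq σ] (A : Transducer σ) (E : Enumeration σ) {L : Set ℕ}
  {k k' N N' : ℕ} {h : History σ} {R : List σ} {m m' m'' : Memory σ} {x : Datum} {p : σ}

/-- In stage `k`, the set `R` is seen to be closed under `x`. -/
def ClosedAt (k : ℕ) (R : List σ) (x : Datum) : Prop := A.KnownAt k R x ∧ A.exits k R x = []
deriving Decidable

/-- The data which in stage `N` are seen to be conjectured by the newest component and to lead out
of it, although some older component is closed under them. -/
def tolerated (h : History σ) (N : ℕ) : List Datum :=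
  ((List.range N).filter fun y => (∃ r ∈ h.1, E.seen N r y) ∧ A.exits N h.1 (some y) ≠ [] ∧
    ∃ R ∈ h.2, A.ClosedAt N R (some y)).map some

/-- The datum `x` is stored in the memory `m` or does not lead out of one of its components. -/
def Retains (m : Memory σ) (x : Datum) : Prop :=
  x ∈ m.stored ∨ ∃ R ∈ m.history.components, A.Closed R x

/-- Raising the bound to the code of `x` makes new data tolerated. -/
def Reveals (m : Memory σ) (x : Datum) : Prop :=
  ∃ y ∈ A.tolerated E m.history (encode x),
    y ∉ A.tolerated E m.history m.bound ∧ y ∉ m.stored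
deriving Decidable

/-- The memory after reading `x`, where `h₀`, `h₁` and `h₂` are the histories after the pause
symbol, after `x`, and after all available data. -/
def update (m : Memory σ) (x : Datum) (h₀ h₁ h₂ : History σ) : Memory σ :=
  if h₀ ≠ m.history ∨ x ∉ m.stored ∧
      (h₁ ≠ m.history ∧ x ∉ A.tolerated E m.history m.bound ∨
        A.Reveals E m x ∧ h₂ ≠ m.history) then ⟨h₂, x :: m.stored, 0⟩
  else if x ∈ m.stored then m
  else if A.Reveals E m x then ⟨m.history, x :: m.stored, encode x⟩
  else if h₁ = m.history then m
  else ⟨m.history, x :: m.stored, m.bound⟩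

/-- The transformed learner. -/
def withMemory : Transducer (Memory σ) where
  start := ⟨([A.start], []), [], 0⟩
  next k m x :=
    (A.feed k m.history none).bind fun h₀ => (A.feed k m.history x).bind fun h₁ =>
      ((none :: x :: m.stored).foldlM (A.feed k) m.history).map (A.update E m x h₀ h₁)
  next_mono hk h := by
    simp only [Option.bind_eq_some_iff, Option.map_eq_some_iff] at h ⊢
    obtain ⟨h₀, e₀, h₁, e₁, h₂, e₂, h⟩ := h
    exact ⟨h₀, feed_mono hk e₀, h₁, feed_mono hk e₁, h₂, feedAll_mono hk e₂, h⟩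

/-- The possible transitions of the transformed learner, described without reference to stages. -/
inductive Transition (m : Memory σ) (x : Datum) : Memory σ → Prop
  | idle (none_closed : A.Closed m.history.1 none)
      (known : x ∈ m.stored ∨ A.Closed m.history.1 x ∧ ¬ A.Reveals E m x) : Transition m x m
  | tolerate (notMem : x ∉ m.stored) (none_closed : A.Closed m.history.1 none)
      (not_closed : ¬ A.Closed m.history.1 x) (mem : x ∈ A.tolerated E m.history m.bound)
      (not_reveals : ¬ A.Reveals E m x) : Transition m x ⟨m.history, x :: m.stored, m.bound⟩
  | raise (notMem : x ∉ m.stored) (none_closed : A.Closed m.history.1 none)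
      (closed : A.Closed m.history.1 x) (stored_closed : ∀ y ∈ m.stored, A.Closed m.history.1 y)
      (reveals : A.Reveals E m x) : Transition m x ⟨m.history, x :: m.stored, encode x⟩
  | extend (k : ℕ) (h : History σ)
      (feed_eq : (none :: x :: m.stored).foldlM (A.feed k) m.history = some h)
      (ne : h ≠ m.history)
      (cause : ¬ A.Closed m.history.1 none ∨ x ∉ m.stored ∧
        (¬ A.Closed m.history.1 x ∧ x ∉ A.tolerated E m.history m.bound ∨ A.Reveals E m x)) :
      Transition m x ⟨h, x :: m.stored, 0⟩

variable {A E}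

theorem ClosedAt.closed (h : A.ClosedAt k R x) : A.Closed R x := h.1.exits_eq_nil_iff.1 h.2

theorem ClosedAt.mono (hk : k ≤ k') (h : A.ClosedAt k R x) : A.ClosedAt k' R x :=
  ⟨h.1.mono hk, (h.1.exits_eq hk).trans h.2⟩

theorem Closed.exists_closedAt (h : A.Closed R x) : ∃ k, A.ClosedAt k R x := by
  obtain ⟨k, hk⟩ := exists_knownAt fun r hr => (h r hr).imp fun q hq => hq.2
  exact ⟨k, hk, hk.exits_eq_nil_iff.2 h⟩

theorem exits_ne_nil_mono (hk : k ≤ k') (h : A.exits k R x ≠ []) : A.exits k' R x ≠ [] := by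
  obtain ⟨q, hq⟩ := List.exists_mem_of_ne_nil _ h
  obtain ⟨hqR, r, hr, hstep⟩ := mem_exits.1 hq
  exact List.ne_nil_of_mem (mem_exits.2 ⟨hqR, r, hr, A.next_mono hk hstep⟩)

theorem mem_tolerated : x ∈ A.tolerated E h N ↔ ∃ y, x = some y ∧ y < N ∧
    (∃ r ∈ h.1, E.seen N r y) ∧ A.exits N h.1 x ≠ [] ∧ ∃ R ∈ h.2, A.ClosedAt N R x := by
  simp only [tolerated, List.mem_map, List.mem_filter, List.mem_range, decide_eq_true_eq]
  constructor
  · rintro ⟨y, ⟨hy, h⟩, rfl⟩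
    exact ⟨y, rfl, hy, h⟩
  · rintro ⟨y, rfl, hy, h⟩
    exact ⟨y, ⟨hy, h⟩, rfl⟩

theorem tolerated_mono (hN : N ≤ N') : A.tolerated E h N ⊆ A.tolerated E h N' := by
  intro x hx
  obtain ⟨y, rfl, hy, ⟨r, hr, hseen⟩, hexits, R, hR, hclosed⟩ := mem_tolerated.1 hx
  exact mem_tolerated.2 ⟨y, rfl, hy.trans_le hN, ⟨r, hr, E.seen_mono hN hseen⟩,
    exits_ne_nil_mono hN hexits, R, hR, hclosed.mono hN⟩

theorem not_closed_of_mem_tolerated (hx : x ∈ A.tolerated E h N) : ¬ A.Closed h.1 x := by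
  obtain ⟨-, -, -, -, hexits, -⟩ := mem_tolerated.1 hx
  intro hclosed
  obtain ⟨q, hq⟩ := List.exists_mem_of_ne_nil _ hexits
  obtain ⟨hqR, r, hr, hstep⟩ := mem_exits.1 hq
  obtain ⟨q', hq', hstep'⟩ := hclosed r hr
  exact hqR (hstep'.unique ⟨N, hstep⟩ ▸ hq')

theorem exists_closed_of_mem_tolerated (hx : x ∈ A.tolerated E h N) :
    ∃ R ∈ h.components, A.Closed R x := by
  obtain ⟨-, -, -, -, -, R, hR, hclosed⟩ := mem_tolerated.1 hx
  exact ⟨R, List.mem_cons_of_mem _ hR, hclosed.closed⟩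

theorem exists_mem_set_of_mem_tolerated (hx : x ∈ A.tolerated E h N) :
    ∃ y, x = some y ∧ ∃ r ∈ h.1, y ∈ E.set r := by
  obtain ⟨y, rfl, -, ⟨r, hr, hseen⟩, -⟩ := mem_tolerated.1 hx
  exact ⟨y, rfl, r, hr, N, hseen⟩

theorem exists_mem_tolerated {y : ℕ} {r : σ} (hr : r ∈ h.1) (hy : y ∈ E.set r)
    (hstep : ∀ r ∈ h.1, ∃ q, A.Step r (some y) q) (hopen : ¬ A.Closed h.1 (some y))
    (hclosed : ∃ R ∈ h.components, A.Closed R (some y)) : ∃ N, some y ∈ A.tolerated E h N := by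
  obtain ⟨R, hR, hclosed⟩ := hclosed
  have hR : R ∈ h.2 := (List.mem_cons.1 hR).resolve_left fun h => hopen (h ▸ hclosed)
  obtain ⟨k₁, hk₁⟩ := hclosed.exists_closedAt
  obtain ⟨k₂, hk₂⟩ := exists_knownAt hstep
  obtain ⟨k₃, hk₃⟩ := hy
  refine ⟨k₁ + k₂ + k₃ + y + 1, mem_tolerated.2 ⟨y, rfl, by omega, ⟨r, hr, E.seen_mono (by omega)
    hk₃⟩, exits_ne_nil_mono (show k₂ ≤ _ by omega) ?_, R, hR, hk₁.mono (by omega)⟩⟩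
  rwa [ne_eq, hk₂.exits_eq_nil_iff]

theorem transition_of_step (h : (A.withMemory E).Step m x m') : A.Transition E m x m' := by
  obtain ⟨k, h⟩ := h
  simp only [withMemory, Option.bind_eq_some_iff, Option.map_eq_some_iff] at h
  obtain ⟨h₀, e₀, h₁, e₁, h₂, e₂, rfl⟩ := h
  have hnone := feed_eq_self_iff e₀
  have hx := feed_eq_self_iff e₁
  have hall := feedAll_eq_self_iff e₂
  simp only [List.mem_cons, forall_eq_or_imp] at hall
  rw [update]
  split_ifs with hext hmem hrev hh₁
  · refine .extend k h₂ e₂ ?_ ?_ <;> grind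
  · exact .idle (by grind) (.inl hmem)
  · refine .raise hmem ?_ ?_ ?_ hrev <;> grind
  · exact .idle (by grind) (.inr (by grind))
  · refine .tolerate hmem ?_ ?_ ?_ hrev <;> grind

theorem Transition.stored_eq (h : A.Transition E m x m') :
    m' = m ∨ m'.stored = x :: m.stored := by
  cases h <;> simp

theorem Transition.stored_subset (h : A.Transition E m x m') : m.stored ⊆ m'.stored := by
  rcases h.stored_eq with rfl | h
  · exact List.Subset.refl _
  · exact h ▸ List.subset_cons_self x m.stored

theorem Transition.components_subset (h : A.Transition E m x m') :
    m.history.components ⊆ m'.history.components := by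
  cases h with
  | idle | tolerate | raise => exact List.Subset.refl _
  | extend k h feed_eq => exact components_subset_of_feedAll feed_eq

theorem Transition.retains_mono (h : A.Transition E m x m') {y : Datum} (hy : A.Retains m y) :
    A.Retains m' y :=
  hy.imp (fun hy => h.stored_subset hy) fun ⟨R, hR, hc⟩ => ⟨R, h.components_subset hR, hc⟩

theorem Transition.retains (h : A.Transition E m x m') : A.Retains m' x := by
  cases h with
  | idle _ known => exact known.imp_right fun hc => ⟨_, m.history.newest_mem_components, hc.1⟩
  | tolerate | raise | extend => exact Or.inl List.mem_cons_self

theorem Reveals.bound_lt (h : A.Reveals E m x) : m.bound < encode x := by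
  obtain ⟨y, hy, hbound, -⟩ := h
  exact not_le.1 fun hle => hbound (tolerated_mono hle hy)

theorem Valid.exists_step {V : σ → Set ℕ} (hA : A.Identifies V L)
    (hv : A.Valid L m.history m.stored) (hx : Legal L x) :
    ∃ m', (A.withMemory E).Step m x m' := by
  obtain ⟨k₀, h₀, e₀⟩ := hv.exists_feed hA legal_none
  obtain ⟨k₁, h₁, e₁⟩ := hv.exists_feed hA hx
  obtain ⟨k₂, h₂, e₂⟩ := hv.exists_feedAll (xs := none :: x :: m.stored) hA
    (List.forall_mem_cons.2 ⟨legal_none, List.forall_mem_cons.2 ⟨hx, hv.legal⟩⟩)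
  refine ⟨A.update E m x h₀ h₁ h₂, k₀ + k₁ + k₂, ?_⟩
  simp only [withMemory, Option.bind_eq_some_iff, Option.map_eq_some_iff]
  exact ⟨h₀, feed_mono (by omega) e₀, h₁, feed_mono (by omega) e₁, h₂,
    feedAll_mono (by omega) e₂, rfl⟩

theorem Transition.valid (h : A.Transition E m x m') (hv : A.Valid L m.history m.stored)
    (hx : Legal L x) : A.Valid L m'.history m'.stored := by
  cases h with
  | idle => exact hv
  | tolerate _ _ _ mem => exact hv.cons_of_closed hx (exists_closed_of_mem_tolerated mem)
  | raise _ _ closed => exact hv.cons_of_closed hx ⟨_, m.history.newest_mem_components, closed⟩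
  | extend k h feed_eq =>
    have hlegal : ∀ y ∈ none :: x :: m.stored, Legal L y :=
      List.forall_mem_cons.2 ⟨legal_none, List.forall_mem_cons.2 ⟨hx, hv.legal⟩⟩
    exact (hv.feedAll hlegal feed_eq).mono
      (List.subset_append_of_subset_left _ (List.subset_cons_self _ _))

theorem Transition.exists_realizes (h : A.Transition E m x m') (hv : A.Valid L m.history m.stored)
    (hx : Legal L x) : ∃ xs : List Datum, xs ≠ [] ∧ (x ∈ xs ∨ x ∈ m'.stored) ∧
      (m'.history ≠ m.history → m'.stored ⊆ xs) ∧
      ∀ p ∈ m.history.1, ∃ w q, A.Realizes L m.history xs m'.history p w q := by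
  cases h with
  | idle none_closed known =>
    rcases known with hmem | ⟨hclosed, -⟩
    · exact ⟨[none], by simp, .inr hmem, by simp, fun p hp =>
        none_closed.exists_realizes legal_none hp⟩
    · exact ⟨[x], by simp, by simp, by simp, fun p hp => hclosed.exists_realizes hx hp⟩
  | tolerate _ none_closed =>
    exact ⟨[none], by simp, by simp, by simp, fun p hp =>
      none_closed.exists_realizes legal_none hp⟩
  | raise _ none_closed =>
    exact ⟨[none], by simp, by simp, by simp, fun p hp =>
      none_closed.exists_realizes legal_none hp⟩
  | extend k h feed_eq =>
    have hlegal : ∀ y ∈ none :: x :: m.stored, Legal L y :=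
      List.forall_mem_cons.2 ⟨legal_none, List.forall_mem_cons.2 ⟨hx, hv.legal⟩⟩
    exact ⟨none :: x :: m.stored, by simp, by simp, fun _ => by simp, fun p hp =>
      hv.exists_realizes_feedAll hlegal feed_eq hp⟩

end Transducer

end Memories

/-! ### Stabilization -/

theorem exists_eventually_const {α β : Type*} [Preorder β] {s : ℕ → α} {f : α → β}
    (hfin : (Set.range fun n => f (s n)).Finite)
    (hlt : ∀ n, s (n + 1) ≠ s n → f (s n) < f (s (n + 1))) : ∃ n₀, ∀ n ≥ n₀, s n = s n₀ := by
  obtain ⟨-, ⟨n₀, rfl⟩, hmax⟩ := hfin.exists_maximal (Set.range_nonempty _)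
  refine ⟨n₀, fun n hn => ?_⟩
  induction n, hn using Nat.le_induction with
  | base => rfl
  | succ n _ ih =>
    by_contra hne
    have hlt' := hlt n (by rwa [ih])
    rw [ih] at hlt'
    exact hlt'.not_ge (hmax ⟨n + 1, rfl⟩ hlt'.le)

theorem exists_succ_ne {α : Type*} {s : ℕ → α} (h : ¬ ∃ n₀, ∀ n ≥ n₀, s n = s n₀) (n : ℕ) :
    ∃ i ≥ n, s (i + 1) ≠ s i := by
  by_contra! hconst
  refine h ⟨n, fun i hi => ?_⟩
  induction i, hi using Nat.le_induction with
  | base => rfl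
  | succ i hi ih => exact (hconst i hi).trans ih

theorem exists_eventually_const_of_shift {α : Type*} {s : ℕ → α} (i : ℕ)
    (h : ∃ n₀, ∀ n ≥ n₀, s (i + n) = s (i + n₀)) : ∃ n₀, ∀ n ≥ n₀, s n = s n₀ := by
  obtain ⟨n₀, hn₀⟩ := h
  refine ⟨i + n₀, fun n hn => ?_⟩
  obtain ⟨d, rfl⟩ := Nat.exists_eq_add_of_le hn
  rw [add_assoc]
  exact hn₀ _ (by omega)

theorem exists_dependent_seq {α : Type*} {P : ℕ → α → Prop} {R : ℕ → α → α → Prop} {a : α}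
    (ha : P 0 a) (h : ∀ n a, P n a → ∃ b, P (n + 1) b ∧ R n a b) :
    ∃ f : ℕ → α, f 0 = a ∧ ∀ n, P n (f n) ∧ R n (f n) (f (n + 1)) := by
  choose g hg hR using h
  let f (n : ℕ) : {a // P n a} := Nat.rec ⟨a, ha⟩ (fun n a => ⟨g n a a.2, hg n a a.2⟩) n
  exact ⟨fun n => (f n).1, rfl, fun n => ⟨(f n).2, hR n (f n).1 (f n).2⟩⟩

theorem stored_subset_of_le {α μ : Type*} {D : μ → List α} {m : ℕ → μ} {x : ℕ → α}
    (hD : ∀ t, m (t + 1) = m t ∨ D (m (t + 1)) = x t :: D (m t)) {s t : ℕ} (hst : s ≤ t) :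
    D (m s) ⊆ D (m t) := by
  induction t, hst using Nat.le_induction with
  | base => exact List.Subset.refl _
  | succ t _ ih =>
    rcases hD t with h | h
    · rwa [h]
    · rw [h]
      exact List.subset_cons_of_subset _ ih

namespace Transducer

variable {σ : Type*} {A : Transducer σ} {V : σ → Set ℕ} {L : Set ℕ} {h h' : History σ}
  {p r : σ} {x : Datum} {k : ℕ} {D xs : List Datum}

theorem Connected.exists_loop (hc : A.Connected L h) (hp : p ∈ h.1) (hr : r ∈ h.1)
    (hx : Legal L x) (hclosed : A.Closed h.1 x) : ∃ w, A.LegalRun L p w r ∧ x ∈ w := by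
  obtain ⟨q, hq, hstep⟩ := hclosed p hp
  obtain ⟨w, hw⟩ := hc.inner _ h.newest_mem_components q hq r hr
  exact ⟨[x] ++ w, (hstep.legalRun hx).append hw, by simp⟩

open Classical in
theorem Valid.eq_of_mem_newest (hA : A.Identifies V L) (hv : A.Valid L h D)
    (hnone : A.Closed h.1 none)
    (hcover : ∀ l ∈ L, some l ∈ D ∨ ∃ R ∈ h.components, A.Closed R (some l))
    (hfin : {l ∈ L | ¬ A.Closed h.1 (some l)}.Finite) (hr : r ∈ h.1) : V r = L := by
  obtain ⟨p, hp, w₁, hw₁, hsub⟩ := hv.covers (hfin.toFinset.toList.map some) (by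
    intro b hb
    obtain ⟨l, hl, rfl⟩ := List.mem_map.1 hb
    have hlL : l ∈ L := ((hfin.mem_toFinset).1 (Finset.mem_toList.1 hl)).1
    exact ⟨legal_some.2 hlL, hcover l hlL⟩)
  obtain ⟨w₂, hw₂⟩ := hv.inner _ h.newest_mem_components p hp r hr
  let x (n : ℕ) : Datum := if n ∈ L ∧ A.Closed h.1 (some n) then some n else none
  have hloop (n : ℕ) : ∃ u, A.LegalRun L r u r ∧ x n ∈ u := by
    by_cases hn : n ∈ L ∧ A.Closed h.1 (some n)
    · simpa only [x, if_pos hn] using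
        hv.toConnected.exists_loop hr hr (legal_some.2 hn.1) hn.2
    · simpa only [x, if_neg hn] using hv.toConnected.exists_loop hr hr legal_none hnone
  choose u hu hxu using hloop
  obtain ⟨-, hconv⟩ := hA.of_words (p := fun _ => r) (hw₁.append hw₂)
    (fun n => List.ne_nil_of_mem (hxu n)) hu (fun l hl => by
      by_cases hc : A.Closed h.1 (some l)
      · exact Or.inr ⟨l, by simpa only [x, if_pos (And.intro hl hc)] using hxu l⟩
      · exact Or.inl (List.mem_append_left _ (hsub (List.mem_map.2 ⟨l, by simp [hl, hc], rfl⟩))))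
  exact hconv.exists.choose_spec

theorem Realizes.mem_states_or_visits {h : ℕ → History σ} {xs u : ℕ → List Datum} {p : ℕ → σ}
    (hu : ∀ n, A.Realizes L (h n) (xs n) (h (n + 1)) (p n) (u n) (p (n + 1))) {n : ℕ}
    (hr : r ∈ (h n).states) : r ∈ (h 0).states ∨ ∃ i, A.Visits (p i) (u i) r := by
  induction n with
  | zero => exact Or.inl hr
  | succ n ih =>
    rcases (hu n).visits r hr with hr | hr
    · exact ih hr
    · exact Or.inr ⟨n, hr⟩

section Stabilization

variable [DecidableEq σ] {E : Enumeration σ} {m : ℕ → Memory σ} {x : ℕ → Datum}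

theorem valid_of_transitions (hm : ∀ n, A.Transition E (m n) (x n) (m (n + 1)))
    (hx : ∀ n, Legal L (x n)) (hv : A.Valid L (m 0).history (m 0).stored) (n : ℕ) :
    A.Valid L (m n).history (m n).stored := by
  induction n with
  | zero => exact hv
  | succ n ih => exact (hm n).valid ih (hx n)

theorem Transition.history_eq_or_potential_lt {m m' : Memory σ} {x : Datum}
    (h : A.Transition E m x m') :
    m'.history = m.history ∨ m.history.potential < m'.history.potential := by
  cases h with
  | idle | tolerate | raise => exact Or.inl rfl
  | extend k h feed_eq =>
    exact (feedAll_eq_or_potential_lt feed_eq).imp And.left And.right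

theorem history_eventually_const_of_finite (hm : ∀ n, A.Transition E (m n) (x n) (m (n + 1)))
    (hfin : {r | ∃ n, r ∈ (m n).history.states}.Finite) :
    ∃ n₀, ∀ n ≥ n₀, (m n).history = (m n₀).history :=
  exists_eventually_const (s := fun n => (m n).history) (History.finite_range_potential hfin)
    fun n hne => (hm n).history_eq_or_potential_lt.resolve_left hne

theorem history_eventually_const (hA : A.Identifies V L)
    (hm : ∀ n, A.Transition E (m n) (x n) (m (n + 1))) (hx : ∀ n, Legal L (x n))
    (hv : A.Valid L (m 0).history (m 0).stored)
    (hB : ∀ b ∈ xs, Legal L b ∧ A.Retains (m 0) b)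
    (hcover : ∀ l ∈ L, some l ∈ xs ∨ ∃ n, x n = some l) :
    ∃ n₀, ∀ n ≥ n₀, (m n).history = (m n₀).history := by
  by_contra hcon
  have hchange := exists_succ_ne (s := fun n => (m n).history) hcon
  choose ys hne hmem hstored hreal using fun n =>
    (hm n).exists_realizes (valid_of_transitions hm hx hv n) (hx n)
  obtain ⟨p₀, hp₀, w, hw, hsub⟩ := hv.covers xs hB
  obtain ⟨p, rfl, hp⟩ := exists_dependent_seq (P := fun n p => p ∈ (m n).history.1)
    (R := fun n p p' => ∃ u, A.Realizes L (m n).history (ys n) (m (n + 1)).history p u p') hp₀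
    fun n p hp => by
      obtain ⟨u, q, hu⟩ := hreal n p hp
      exact ⟨q, hu.mem, u, hu⟩
  choose _ u hu using hp
  obtain ⟨hfin, -⟩ := hA.of_words hw (fun n h => hne n (List.subset_nil.1 (h ▸ (hu n).subset)))
    (fun n => (hu n).legalRun) (fun l hl => by
      rcases hcover l hl with hxs | ⟨n, hn⟩
      · exact Or.inl (hsub hxs)
      right
      rcases hmem n with hys | hst <;> rw [hn] at *
      · exact ⟨n, (hu n).subset hys⟩
      · obtain ⟨i, hi, hne⟩ := hchange (n + 1)
        exact ⟨i, (hu i).subset (hstored i hne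
          (stored_subset_of_le (D := Memory.stored) (fun n => (hm n).stored_eq)
            (hi.trans i.le_succ) hst))⟩)
  exact hcon <| history_eventually_const_of_finite hm
    (((m 0).history.states.toFinset.finite_toSet.union hfin).subset fun r ⟨n, hr⟩ => by
      simpa using Realizes.mem_states_or_visits hu hr)

end Stabilization

end Transducer

namespace Transducer

theorem finite_setOf_not_closed {σ : Type*} {A : Transducer σ} {L : Set ℕ} {D xs : List Datum}
    {R : List σ} {x : ℕ → Datum} (hcover : ∀ l ∈ L, some l ∈ xs ∨ ∃ n, x n = some l)
    (hx : ∀ n, x n ∈ D ∨ A.Closed R (x n)) : {l ∈ L | ¬ A.Closed R (some l)}.Finite := by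
  refine ((xs ++ D).toFinset.finite_toSet.preimage (Option.some_injective ℕ).injOn).subset ?_
  rintro l ⟨hl, hopen⟩
  have hmem : some l ∈ xs ∨ some l ∈ D := by
    refine (hcover l hl).imp_right fun ⟨n, hn⟩ => ?_
    rw [← hn] at hopen ⊢
    exact (hx n).resolve_right hopen
  simpa using hmem

section MemoryStabilization

variable {σ : Type*} [DecidableEq σ] {A : Transducer σ} {E : Enumeration σ} {L : Set ℕ}

section

variable {m m' : Memory σ} {x y : Datum}

theorem Transition.none_closed (h : A.Transition E m x m') (hh : m'.history = m.history) :
    A.Closed m.history.1 none := by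
  cases h with
  | idle hnone | tolerate _ hnone | raise _ hnone => exact hnone
  | extend k h _ ne => exact absurd hh ne

theorem Transition.mem_stored_or_closed (h : A.Transition E m x m')
    (hh : m'.history = m.history) : x ∈ m'.stored ∨ A.Closed m.history.1 x := by
  cases h with
  | idle _ known => exact known.imp_right And.left
  | tolerate | raise | extend => exact Or.inl List.mem_cons_self

theorem Transition.stored_ssubset (h : A.Transition E m x m') (hh : m'.history = m.history)
    (hne : m' ≠ m) : m.stored.toFinset ⊂ m'.stored.toFinset := by
  cases h with
  | idle => exact absurd rfl hne
  | tolerate hx | raise hx => simpa using Finset.ssubset_insert (by simpa using hx)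
  | extend k h _ ne => exact absurd hh ne

theorem Transition.stored_subset_of_bound_eq (h : A.Transition E m x m')
    (hh : m'.history = m.history) (hb : m'.bound = m.bound) :
    m'.stored ⊆ A.tolerated E m.history m.bound ++ m.stored := by
  cases h with
  | idle => exact List.subset_append_right _ _
  | tolerate _ _ _ mem => exact List.cons_subset.2 (by simp [mem])
  | raise _ _ _ _ reveals => exact absurd hb reveals.bound_lt.ne'
  | extend k h _ ne => exact absurd hh ne

theorem Transition.bound_eq_of_not_closed (h : A.Transition E m x m')
    (hh : m'.history = m.history) (hy : y ∈ m.stored) (hopen : ¬ A.Closed m.history.1 y) :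
    m'.bound = m.bound := by
  cases h with
  | idle | tolerate => rfl
  | raise _ _ _ stored_closed => exact absurd (stored_closed y hy) hopen
  | extend k h _ ne => exact absurd hh ne

theorem Transition.tolerated_ssubset (h : A.Transition E m x m') (hh : m'.history = m.history)
    (hne : m' ≠ m) (hclosed : A.Closed m.history.1 x) :
    (A.tolerated E m.history m.bound).toFinset ⊂
      (A.tolerated E m'.history m'.bound).toFinset := by
  cases h with
  | idle => exact absurd rfl hne
  | tolerate _ _ not_closed => exact absurd hclosed not_closed
  | raise _ _ _ _ reveals =>
    obtain ⟨y, hy, hbound, -⟩ := id reveals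
    refine Finset.ssubset_iff_of_subset (fun z hz => ?_) |>.2 ⟨y, by simpa using hy,
      by simpa using hbound⟩
    simpa using tolerated_mono reveals.bound_lt.le (List.mem_toFinset.1 hz)
  | extend k h _ ne => exact absurd hh ne

end

variable {m : ℕ → Memory σ} {x : ℕ → Datum} {y : Datum} {xs : List Datum}

theorem retains_of_le (hm : ∀ n, A.Transition E (m n) (x n) (m (n + 1))) {i j : ℕ} (hij : i ≤ j)
    (hy : A.Retains (m i) y) : A.Retains (m j) y := by
  induction j, hij using Nat.le_induction with
  | base => exact hy
  | succ j _ ih => exact (hm j).retains_mono ih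

theorem retains_of_lt (hm : ∀ n, A.Transition E (m n) (x n) (m (n + 1))) {i j : ℕ}
    (hij : i < j) : A.Retains (m j) (x i) :=
  retains_of_le hm hij (hm i).retains

theorem eventually_const_of_bound_const (hm : ∀ n, A.Transition E (m n) (x n) (m (n + 1)))
    (hh : ∀ n, (m n).history = (m 0).history) (hb : ∀ n, (m n).bound = (m 0).bound) :
    ∃ n₀, ∀ n ≥ n₀, m n = m n₀ := by
  have hstored (n : ℕ) :
      (m n).stored ⊆ A.tolerated E (m 0).history (m 0).bound ++ (m 0).stored := by
    induction n with
    | zero => exact List.subset_append_right _ _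
    | succ n ih =>
      have hsub := (hm n).stored_subset_of_bound_eq (by rw [hh, hh n]) (by rw [hb, hb n])
      rw [hh, hb] at hsub
      exact List.Subset.trans hsub (List.append_subset.2 ⟨List.subset_append_left _ _, ih⟩)
  exact exists_eventually_const (f := fun m => m.stored.toFinset)
    ((Set.finite_Iic (A.tolerated E (m 0).history (m 0).bound ++ (m 0).stored).toFinset).subset
      (Set.range_subset_iff.2 fun n y hy => by simpa using hstored n (List.mem_toFinset.1 hy)))
    fun n hne => (hm n).stored_ssubset (by rw [hh, hh n]) hne

theorem eventually_const_of_forall_closed (hA : A.Identifies E.set L)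
    (hm : ∀ n, A.Transition E (m n) (x n) (m (n + 1)))
    (hv : A.Valid L (m 0).history (m 0).stored) (hh : ∀ n, (m n).history = (m 0).history)
    (hxs : ∀ b ∈ xs, A.Retains (m 0) b) (hcover : ∀ l ∈ L, some l ∈ xs ∨ ∃ n, x n = some l)
    (hclosed : ∀ n, A.Closed (m 0).history.1 (x n)) : ∃ n₀, ∀ n ≥ n₀, m n = m n₀ := by
  have hfin := finite_setOf_not_closed (D := []) hcover fun n => Or.inr (hclosed n)
  have hset {r : σ} (hr : r ∈ (m 0).history.1) : E.set r = L := by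
    refine hv.eq_of_mem_newest hA ((hm 0).none_closed (hh 1)) (fun l hl => ?_) hfin hr
    rcases hcover l hl with hl | ⟨n, hn⟩
    · exact hxs _ hl
    · exact Or.inr ⟨_, (m 0).history.newest_mem_components, hn ▸ hclosed n⟩
  refine exists_eventually_const (f := fun m => (A.tolerated E m.history m.bound).toFinset) ?_
    fun n hne => (hm n).tolerated_ssubset (by rw [hh, hh n]) hne (by rw [hh]; exact hclosed n)
  refine (Set.finite_Iic (hfin.toFinset.image some)).subset
    (Set.range_subset_iff.2 fun n z hz => ?_)
  rw [hh, List.mem_toFinset] at hz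
  obtain ⟨l, rfl, r, hr, hl⟩ := exists_mem_set_of_mem_tolerated hz
  exact Finset.mem_image_of_mem _ (hfin.mem_toFinset.2
    ⟨hset hr ▸ hl, not_closed_of_mem_tolerated hz⟩)

theorem eventually_const_of_history_const (hA : A.Identifies E.set L)
    (hm : ∀ n, A.Transition E (m n) (x n) (m (n + 1)))
    (hv : A.Valid L (m 0).history (m 0).stored) (hh : ∀ n, (m n).history = (m 0).history)
    (hxs : ∀ b ∈ xs, A.Retains (m 0) b) (hcover : ∀ l ∈ L, some l ∈ xs ∨ ∃ n, x n = some l) :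
    ∃ n₀, ∀ n ≥ n₀, m n = m n₀ := by
  by_cases hclosed : ∀ n, A.Closed (m 0).history.1 (x n)
  · exact eventually_const_of_forall_closed hA hm hv hh hxs hcover hclosed
  obtain ⟨i, hopen⟩ := not_forall.1 hclosed
  have hstored : x i ∈ (m (i + 1)).stored :=
    ((hm i).mem_stored_or_closed (by rw [hh, hh i])).resolve_right (by rwa [hh])
  refine exists_eventually_const_of_shift (i + 1) (eventually_const_of_bound_const
    (fun n => hm (i + 1 + n)) (fun n => by rw [hh, hh (i + 1 + 0)]) fun n => ?_)
  induction n with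
  | zero => rfl
  | succ n ih =>
    refine ((hm (i + 1 + n)).bound_eq_of_not_closed (by rw [hh, hh (i + 1 + n)]) (y := x i) ?_
      (by rwa [hh])).trans ih
    exact stored_subset_of_le (D := Memory.stored) (fun n => (hm n).stored_eq)
      (Nat.le_add_right (i + 1) n) hstored

theorem memory_eventually_const (hA : A.Identifies E.set L)
    (hm : ∀ n, A.Transition E (m n) (x n) (m (n + 1))) (hx : ∀ n, Legal L (x n))
    (hv : A.Valid L (m 0).history (m 0).stored)
    (hxs : ∀ b ∈ xs, Legal L b ∧ A.Retains (m 0) b)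
    (hcover : ∀ l ∈ L, some l ∈ xs ∨ ∃ n, x n = some l) : ∃ n₀, ∀ n ≥ n₀, m n = m n₀ := by
  obtain ⟨i, hi⟩ := history_eventually_const hA hm hx hv hxs hcover
  refine exists_eventually_const_of_shift i <| eventually_const_of_history_const
    (xs := xs ++ (List.range i).map x) hA (fun n => hm (i + n))
    (valid_of_transitions hm hx hv i) (fun n => hi (i + n) (by omega)) ?_ fun l hl => ?_
  · simp only [List.mem_append, List.mem_map, List.mem_range]
    rintro b (hb | ⟨j, hj, rfl⟩)
    · exact retains_of_le hm (Nat.zero_le i) (hxs b hb).2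
    · exact retains_of_lt hm hj
  · simp only [List.mem_append, List.mem_map, List.mem_range]
    rcases hcover l hl with hl | ⟨n, hn⟩
    · exact Or.inl (Or.inl hl)
    rcases lt_or_ge n i with hni | hni
    · exact Or.inl (Or.inr ⟨n, hni, hn⟩)
    · exact Or.inr ⟨n - i, by rwa [Nat.add_sub_cancel' hni]⟩

end MemoryStabilization

end Transducer

/-! ### Settled memories -/

namespace Transducer

section Settled

variable {σ : Type*} [DecidableEq σ]

/-- No tolerated datum is missing: the newest component is closed under the pause symbol, and each
element of `L` which leads out of it is stored or tolerated. -/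
structure Saturated (A : Transducer σ) (E : Enumeration σ) (L : Set ℕ) (m : Memory σ) :
    Prop where
  none_closed : A.Closed m.history.1 none
  mem : ∀ l ∈ L, A.Closed m.history.1 (some l) ∨ some l ∈ m.stored ∨
    some l ∈ A.tolerated E m.history m.bound

/-- The memory retains all of `L`, and it is saturated if `L` is infinite. Texts for `L` lead to
such memories, and then the conjecture has to equal `L`. -/
structure Settled (A : Transducer σ) (E : Enumeration σ) (L : Set ℕ) (m : Memory σ) : Prop where
  valid : A.Valid L m.history m.stored
  retains : ∀ l ∈ L, A.Retains m (some l)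
  finite_or_saturated : L.Finite ∨ A.Saturated E L m

/-- The memory `m` is changed to `m'` by some datum for `L`. -/
def Changes (A : Transducer σ) (E : Enumeration σ) (L : Set ℕ) (m' m : Memory σ) : Prop :=
  m' ≠ m ∧ ∃ x, Legal L x ∧ A.Transition E m x m'

variable {A : Transducer σ} {E : Enumeration σ} {L : Set ℕ}

section

variable {m m' : Memory σ} {x : Datum} {r : σ}

theorem Transition.mem_stored_or_not_reveals (h : A.Transition E m x m') (heq : m' = m) :
    x ∈ m.stored ∨ ¬ A.Reveals E m x := by
  cases h with
  | idle _ known => exact known.imp_right And.right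
  | tolerate | raise | extend => exact absurd (congrArg (·.stored.length) heq) (by simp)

theorem Saturated.set_eq (hA : A.Identifies E.set L) (hs : A.Saturated E L m)
    (hv : A.Valid L m.history m.stored) (hret : ∀ l ∈ L, A.Retains m (some l))
    (hr : r ∈ m.history.1) : E.set r = L := by
  refine hv.eq_of_mem_newest hA hs.none_closed hret ?_ hr
  refine ((m.stored ++ A.tolerated E m.history m.bound).toFinset.finite_toSet.preimage
    (Option.some_injective ℕ).injOn).subset ?_
  rintro l ⟨hl, hopen⟩
  simpa using (hs.mem l hl).resolve_left hopen

theorem Saturated.not_reveals (hs : A.Saturated E L m) (hset : ∀ r ∈ m.history.1, E.set r = L) :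
    ¬ A.Reveals E m x := by
  rintro ⟨y, hy, hbound, hstored⟩
  obtain ⟨l, rfl, r, hr, hl⟩ := exists_mem_set_of_mem_tolerated hy
  rcases hs.mem l (hset r hr ▸ hl) with h | h | h
  exacts [not_closed_of_mem_tolerated hy h, hstored h, hbound h]

theorem Saturated.eq_or_stores (hs : A.Saturated E L m)
    (hset : ∀ r ∈ m.history.1, E.set r = L) (hx : Legal L x) (h : A.Transition E m x m') :
    m' = m ∨ m' = ⟨m.history, x :: m.stored, m.bound⟩ := by
  have hrev := hs.not_reveals hset (x := x)
  cases h with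
  | idle => exact Or.inl rfl
  | tolerate => exact Or.inr rfl
  | raise _ _ _ _ reveals => exact absurd reveals hrev
  | extend k h feed_eq ne cause =>
    have hmem : A.Closed m.history.1 x ∨ x ∈ m.stored ∨
        x ∈ A.tolerated E m.history m.bound := by
      cases x with
      | none => exact Or.inl hs.none_closed
      | some l => exact hs.mem l (legal_some.1 hx)
    have := hs.none_closed
    tauto

theorem Saturated.transition (hs : A.Saturated E L m) (hset : ∀ r ∈ m.history.1, E.set r = L)
    (hx : Legal L x) (h : A.Transition E m x m') : A.Saturated E L m' := by
  rcases hs.eq_or_stores hset hx h with rfl | rfl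
  · exact hs
  · exact ⟨hs.none_closed, fun l hl => (hs.mem l hl).imp_right
      (Or.imp_left (List.mem_cons_of_mem _))⟩

theorem Settled.set_eq (hA : A.Identifies E.set L) (hs : A.Settled E L m)
    (hnone : A.Closed m.history.1 none) (hr : r ∈ m.history.1) : E.set r = L := by
  rcases hs.finite_or_saturated with hfin | hsat
  · exact hs.valid.eq_of_mem_newest hA hnone hs.retains (hfin.subset fun l hl => hl.1) hr
  · exact hsat.set_eq hA hs.valid hs.retains hr

theorem Settled.transition (hA : A.Identifies E.set L) (hs : A.Settled E L m) (hx : Legal L x)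
    (h : A.Transition E m x m') : A.Settled E L m' :=
  ⟨h.valid hs.valid hx, fun l hl => h.retains_mono (hs.retains l hl),
    hs.finite_or_saturated.imp_right fun hsat =>
      hsat.transition (fun _ => hsat.set_eq hA hs.valid hs.retains) hx h⟩

end

variable {m : ℕ → Memory σ} {x : ℕ → Datum}

theorem Settled.eventually_const (hA : A.Identifies E.set L) (hs : A.Settled E L (m 0))
    (hm : ∀ n, A.Transition E (m n) (x n) (m (n + 1))) (hx : ∀ n, Legal L (x n)) :
    ∃ n₀, ∀ n ≥ n₀, m n = m n₀ := by
  rcases hs.finite_or_saturated with hfin | hsat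
  · refine memory_eventually_const (xs := hfin.toFinset.toList.map some) hA hm hx hs.valid ?_
      fun l hl => Or.inl (by simpa using hl)
    simp only [List.mem_map, Finset.mem_toList, hfin.mem_toFinset]
    rintro - ⟨l, hl, rfl⟩
    exact ⟨legal_some.2 hl, hs.retains l hl⟩
  have hset (r) (hr : r ∈ (m 0).history.1) : E.set r = L :=
    hsat.set_eq hA hs.valid hs.retains hr
  have key (n : ℕ) : A.Saturated E L (m n) ∧ (m n).history = (m 0).history ∧
      (m n).bound = (m 0).bound := by
    induction n with
    | zero => exact ⟨hsat, rfl, rfl⟩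
    | succ n ih =>
      obtain ⟨hsat', hh, hb⟩ := ih
      rw [← hh] at hset
      refine ⟨hsat'.transition hset (hx n) (hm n), ?_⟩
      rcases hsat'.eq_or_stores hset (hx n) (hm n) with h | h <;> rw [h] <;> exact ⟨hh, hb⟩
  exact eventually_const_of_bound_const hm (fun n => (key n).2.1) fun n => (key n).2.2

theorem Settled.acc {m : Memory σ} (hA : A.Identifies E.set L) (hs : A.Settled E L m) :
    Acc (A.Changes E L) m := by
  by_contra hacc
  obtain ⟨m, rfl, hchanges⟩ := not_acc_iff_exists_descending_chain.1 hacc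
  choose hne x hx hm using hchanges
  obtain ⟨n₀, hn₀⟩ := hs.eventually_const hA hm hx
  exact hne n₀ (hn₀ _ n₀.le_succ)

theorem settled_of_forall_transition {m : Memory σ} {xs : List Datum}
    (hA : A.Identifies E.set L) (hm : ∀ n, A.Transition E m (x n) m)
    (hv : A.Valid L m.history m.stored) (hxs : ∀ b ∈ xs, A.Retains m b)
    (hcover : ∀ l ∈ L, some l ∈ xs ∨ ∃ n, x n = some l) : A.Settled E L m := by
  have hret (l) (hl : l ∈ L) : A.Retains m (some l) :=
    (hcover l hl).elim (hxs _) fun ⟨n, hn⟩ => hn ▸ (hm n).retains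
  refine ⟨hv, hret, or_iff_not_imp_left.2 fun hinf => ⟨(hm 0).none_closed rfl, fun l hl => ?_⟩⟩
  have hfin := finite_setOf_not_closed hcover fun n => (hm n).mem_stored_or_closed rfl
  by_contra! hl'
  obtain ⟨hopen, hstored, hbound⟩ := hl'
  obtain ⟨r, hr⟩ := List.exists_mem_of_ne_nil _ hv.nonempty
  obtain ⟨N, hN⟩ : ∃ N, some l ∈ A.tolerated E m.history N := by
    refine exists_mem_tolerated hr ?_ (fun r hr => hA.exists_step (hv.reachable r ?_)
      (legal_some.2 hl)) hopen ((hret l hl).resolve_left hstored)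
    · rwa [hv.eq_of_mem_newest hA ((hm 0).none_closed rfl) hret hfin hr]
    · exact m.history.newest_subset_states hr
  obtain ⟨l', hl', hnotMem⟩ := Set.Infinite.exists_notMem_finset hinf
    ((xs ++ m.stored).reduceOption.toFinset ∪ Finset.range N)
  simp only [Finset.mem_union, List.mem_toFinset, List.reduceOption_mem_iff, List.mem_append,
    Finset.mem_range, not_or, not_lt] at hnotMem
  obtain ⟨⟨hl'xs, hl'stored⟩, hN'⟩ := hnotMem
  obtain ⟨n, hn⟩ := (hcover l' hl').resolve_left hl'xs
  refine ((hm n).mem_stored_or_not_reveals rfl).elim (hn ▸ hl'stored) fun hrev => hrev ?_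
  exact ⟨some l, tolerated_mono (by simp [hn]; omega) hN, hbound, hstored⟩

end Settled

theorem valid_start {σ : Type*} (A : Transducer σ) (L : Set ℕ) :
    A.Valid L ([A.start], []) [] where
  nonempty := List.cons_ne_nil _ _
  inner R hR r hr r' hr' := by
    obtain rfl := List.mem_singleton.1 hR
    rw [List.mem_singleton.1 hr, List.mem_singleton.1 hr']
    exact .refl _
  outer := List.pairwise_singleton _ _
  reachable r hr := by
    obtain ⟨R, hR, hr⟩ := History.mem_states.1 hr
    obtain rfl := List.mem_singleton.1 hR
    exact List.mem_singleton.1 hr ▸ .refl _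
  legal := by simp
  covers B hB := by
    obtain ⟨r, hr, hrun⟩ := Closed.exists_run (R := [A.start]) (B := B) (fun b hb => by
      obtain ⟨R, hR, hc⟩ := (hB b hb).2.resolve_left List.not_mem_nil
      exact List.mem_singleton.1 hR ▸ hc) (List.mem_singleton_self _)
    exact ⟨r, hr, B, ⟨fun b hb => (hB b hb).1, hrun⟩, List.Subset.refl _⟩

section Convergence

variable {σ : Type*} [DecidableEq σ] {A : Transducer σ} {E : Enumeration σ} {L : Set ℕ}
  {T : ℕ → Datum}

theorem exists_path_withMemory (hA : A.Identifies E.set L) (hT : ∀ t, Legal L (T t)) :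
    ∃ m, (A.withMemory E).IsPath T m ∧ ∀ t, A.Valid L (m t).history (m t).stored := by
  obtain ⟨m, h0, hm⟩ := exists_dependent_seq (a := (A.withMemory E).start)
    (P := fun _ m => A.Valid L m.history m.stored)
    (R := fun t m m' => (A.withMemory E).Step m (T t) m') (A.valid_start L) fun t m hv => by
      obtain ⟨m', hm'⟩ := hv.exists_step (E := E) hA (hT t)
      exact ⟨m', (transition_of_step hm').valid hv (hT t), hm'⟩
  exact ⟨m, ⟨h0, fun t => (hm t).2⟩, fun t => (hm t).1⟩

theorem exists_settled_path (hA : A.Identifies E.set L) (hT : IsText T L) :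
    ∃ m, (A.withMemory E).IsPath T m ∧ ∃ m₀, A.Settled E L m₀ ∧ ∃ n₀, ∀ n ≥ n₀, m n = m₀ := by
  obtain ⟨m, hpath, hv⟩ := exists_path_withMemory hA hT.legal
  have hm (n : ℕ) : A.Transition E (m n) (T n) (m (n + 1)) := transition_of_step (hpath.2 n)
  have hcover (l) (hl : l ∈ L) : ∃ n, T n = some l := by rwa [← hT] at hl
  obtain ⟨n₀, hn₀⟩ := memory_eventually_const (xs := []) hA hm hT.legal (hv 0) (by simp)
    fun l hl => Or.inr (hcover l hl)
  refine ⟨m, hpath, m n₀, ?_, n₀, hn₀⟩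
  refine settled_of_forall_transition (x := fun n => T (n₀ + n)) (xs := (List.range n₀).map T) hA
    (fun n => ?_) (hv n₀) ?_ fun l hl => ?_
  · simpa [hn₀ (n₀ + n) (by omega), hn₀ (n₀ + n + 1) (by omega)] using hm (n₀ + n)
  · simp only [List.mem_map, List.mem_range]
    rintro - ⟨i, hi, rfl⟩
    exact retains_of_lt hm hi
  · obtain ⟨n, hn⟩ := hcover l hl
    rcases lt_or_ge n n₀ with hlt | hle
    · exact Or.inl (List.mem_map.2 ⟨n, List.mem_range.2 hlt, hn⟩)
    · exact Or.inr ⟨n - n₀, by rwa [Nat.add_sub_cancel' hle]⟩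

end Convergence

end Transducer

/-! ### Targets -/

section Targets

variable {μ : Type*} {B : Transducer μ} {D : μ → List Datum} {G V : Enumeration μ} {m m₀ m' : μ}
  {n s s' : ℕ} {x : Datum}

theorem Enumeration.exists_lt_seen {α : Type*} (E : Enumeration α) {a : α} :
    (∃ s, n < s ∧ E.seen s a n) ↔ n ∈ E.set a :=
  ⟨fun ⟨s, hs⟩ => ⟨s, hs.2⟩, fun ⟨s, hs⟩ => ⟨s + n + 1, by omega, E.seen_mono (by omega) hs⟩⟩

theorem exists_forall_stage {β : Type*} {P : ℕ → β → Prop}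
    (hP : ∀ {k k' b}, k ≤ k' → P k b → P k' b) {l : List β} (h : ∀ b ∈ l, ∃ k, P k b) :
    ∃ k, ∀ b ∈ l, P k b := by
  choose! f hf using h
  exact ⟨(l.map f).sum, fun b hb => hP (List.le_sum_of_mem (List.mem_map_of_mem hb)) (hf b hb)⟩

variable (B V) in
/-- Each element of the finite set `P`, as well as the pause symbol, leads from the memory `m` to
`m` itself or to a memory to which `V` attaches a set including `P`. -/
def Accepts (m : μ) (P : List ℕ) : Prop :=
  ∀ x ∈ none :: P.map some, ∃ m', B.Step m x m' ∧ (m' = m ∨ ∀ w ∈ P, w ∈ V.set m')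

theorem Accepts.exists_stage {P : List ℕ} (h : Accepts B V m P) :
    ∃ k, ∀ x ∈ none :: P.map some, ∃ m' ∈ B.next k m x, m' = m ∨ ∀ w ∈ P, V.seen k m' w := by
  refine exists_forall_stage (fun hk ⟨m', hm', h⟩ => ⟨m', B.next_mono hk hm',
    h.imp_right fun h w hw => V.seen_mono hk (h w hw)⟩) fun x hx => ?_
  obtain ⟨m', ⟨k₁, hk₁⟩, h | h⟩ := h x hx
  · exact ⟨k₁, m', hk₁, Or.inl h⟩
  obtain ⟨k₂, hk₂⟩ := exists_forall_stage (P := fun k w => V.seen k m' w) V.seen_mono h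
  exact ⟨max k₁ k₂, m', B.next_mono (le_max_left _ _) hk₁,
    Or.inr fun w hw => V.seen_mono (le_max_right _ _) (hk₂ w hw)⟩

variable [DecidableEq μ]

variable (D G V) in
/-- A finite part of a target for the memory `m`, where `m₀` is the memory after the pause symbol:
the stored data and what is enumerated in stage `s`, by `G` if the pause symbol does not change the
memory, and into the target of the new memory otherwise. -/
def approx (s : ℕ) (m m₀ : μ) : List ℕ :=
  (D m).reduceOption ++
    (List.range s).filter fun n => if m₀ = m then G.seen s m n else V.seen s m₀ n

theorem mem_approx : n ∈ approx D G V s m m₀ ↔ some n ∈ D m ∨ n < s ∧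
    if m₀ = m then G.seen s m n else V.seen s m₀ n := by
  simp [approx, List.reduceOption_mem_iff]

theorem approx_mono (hs : s ≤ s') : approx D G V s m m₀ ⊆ approx D G V s' m m₀ := by
  intro n hn
  rw [mem_approx] at hn ⊢
  refine hn.imp_right fun ⟨hlt, h⟩ => ⟨hlt.trans_le hs, ?_⟩
  split_ifs at h ⊢
  exacts [G.seen_mono hs h, V.seen_mono hs h]

theorem exists_mem_approx_self :
    (∃ s, n ∈ approx D G V s m m) ↔ some n ∈ D m ∨ n ∈ G.set m := by
  simp only [mem_approx, if_true, exists_or, exists_const, G.exists_lt_seen]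

theorem exists_mem_approx_of_ne (hne : m₀ ≠ m) :
    (∃ s, n ∈ approx D G V s m m₀) ↔ some n ∈ D m ∨ n ∈ V.set m₀ := by
  simp only [mem_approx, if_neg hne, exists_or, exists_const, V.exists_lt_seen]

variable (B D G V) in
/-- The sets attached to memories by `V` satisfy the recursion which defines the languages
announced by a learner with transducer `B`, stored data `D` and conjectures `G`: only finite sets
which are accepted are enumerated. -/
def IsTarget : Prop :=
  ∀ m n, n ∈ V.set m ↔ some n ∈ D m ∨ ∃ s m₀, B.Step m none m₀ ∧ n ∈ approx D G V s m m₀ ∧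
    Accepts B V m (approx D G V s m m₀)

variable (B D G V) in
/-- The condition defining membership of `n` in the target of `m`, with stage `s` for the finite
set to be enumerated and stage `k` for its acceptance. -/
def EnumeratesAt (m : μ) (n s k : ℕ) : Prop :=
  some n ∈ D m ∨ ∃ m₀ ∈ B.next k m none, n ∈ approx D G V s m m₀ ∧
    ∀ x ∈ none :: (approx D G V s m m₀).map some, ∃ m' ∈ B.next k m x,
      m' = m ∨ ∀ w ∈ approx D G V s m m₀, V.seen k m' w

theorem exists_enumeratesAt : (∃ s k, EnumeratesAt B D G V m n s k) ↔
    some n ∈ D m ∨ ∃ s m₀, B.Step m none m₀ ∧ n ∈ approx D G V s m m₀ ∧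
      Accepts B V m (approx D G V s m m₀) := by
  constructor
  · rintro ⟨s, k, hn | ⟨m₀, h₀, hn, hall⟩⟩
    · exact Or.inl hn
    refine Or.inr ⟨s, m₀, ⟨k, h₀⟩, hn, fun x hx => ?_⟩
    obtain ⟨m', hm', h⟩ := hall x hx
    exact ⟨m', ⟨k, hm'⟩, h.imp_right fun h w hw => ⟨k, h w hw⟩⟩
  · rintro (hn | ⟨s, m₀, ⟨k₀, h₀⟩, hn, hall⟩)
    · exact ⟨0, 0, Or.inl hn⟩
    obtain ⟨k, hk⟩ := hall.exists_stage
    refine ⟨s, max k₀ k, Or.inr ⟨m₀, B.next_mono (le_max_left _ _) h₀, hn, fun x hx => ?_⟩⟩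
    obtain ⟨m', hm', h⟩ := hk x hx
    exact ⟨m', B.next_mono (le_max_right _ _) hm', h.imp_right fun h w hw =>
      V.seen_mono (le_max_right _ _) (h w hw)⟩

theorem IsTarget.exists_accepts (hV : IsTarget B D G V) (hn : n ∈ V.set m) (hnD : some n ∉ D m)
    (hx : ∀ l, x = some l → l ∈ V.set m) :
    ∃ P, Accepts B V m P ∧ n ∈ P ∧ x ∈ none :: P.map some := by
  obtain ⟨s, m₀, h₀, hns, hP⟩ := ((hV m n).1 hn).resolve_left hnD
  cases x with
  | none => exact ⟨_, hP, hns, List.mem_cons_self⟩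
  | some l =>
    suffices ∃ s, l ∈ approx D G V s m m₀ ∧ n ∈ approx D G V s m m₀ ∧
        Accepts B V m (approx D G V s m m₀) by
      obtain ⟨s, hl, hns, hP⟩ := this
      exact ⟨_, hP, hns, List.mem_cons_of_mem _ (List.mem_map_of_mem hl)⟩
    rcases (hV m l).1 (hx l rfl) with hl | ⟨s', m₀', h₀', hls', hP'⟩
    · exact ⟨s, mem_approx.2 (Or.inl hl), hns, hP⟩
    obtain rfl := h₀.unique h₀'
    rcases le_total s s' with hs | hs
    · exact ⟨s', hls', approx_mono hs hns, hP'⟩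
    · exact ⟨s, approx_mono hs hls', hns, hP⟩

theorem IsTarget.subset_or_stored (hV : IsTarget B D G V) (h : B.Step m x m')
    (hD : m' = m ∨ D m' = x :: D m) :
    V.set m ⊆ V.set m' ∨ ∃ n, x = some n ∧ n ∉ V.set m ∧ some n ∈ D m' := by
  by_cases heq : m' = m
  · exact Or.inl (heq ▸ subset_rfl)
  replace hD := hD.resolve_left heq
  by_cases! hx : ∃ n, x = some n ∧ n ∉ V.set m
  · obtain ⟨n, rfl, hn⟩ := hx
    exact Or.inr ⟨n, rfl, hn, hD ▸ List.mem_cons_self⟩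
  refine Or.inl fun n hn => ?_
  by_cases hnD : some n ∈ D m
  · exact (hV m' n).2 (Or.inl (hD ▸ List.mem_cons_of_mem x hnD))
  obtain ⟨P, hP, hnP, hxP⟩ := hV.exists_accepts hn hnD hx
  obtain ⟨m'', hm'', hsub⟩ := hP x hxP
  obtain rfl := hm''.unique h
  exact hsub.resolve_left heq n hnP

end Targets

/-! ### Primitive recursiveness -/

section PrimitiveRecursion

variable {α β γ : Type*} [Primcodable α] [Primcodable β] [Primcodable γ]

theorem primrecRel_mem : PrimrecRel fun (a : α) (l : List α) => a ∈ l :=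
  (Primrec.eq.exists_mem_list.comp Primrec.snd Primrec.fst).of_eq fun p => by simp

theorem primrec_option_elim {o : α → Option β} {f : α → γ} {g : α → β → γ} (ho : Primrec o)
    (hf : Primrec f) (hg : Primrec₂ g) : Primrec fun a => (o a).elim (f a) (g a) :=
  (Primrec.option_casesOn ho hf hg).of_eq fun a => by cases o a <;> rfl

theorem primrec_foldlM {f : α → γ} {l : α → List β} {g : α → γ → β → Option γ} (hf : Primrec f)
    (hl : Primrec l) (hg : Primrec fun p : α × γ × β => g p.1 p.2.1 p.2.2) :
    Primrec fun a => (l a).foldlM (g a) (f a) := by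
  refine (Primrec.list_foldl (h := fun a p => p.1.bind fun c => g a c p.2) hl
    (Primrec.option_some.comp hf) (Primrec.option_bind (Primrec.fst.comp Primrec.snd)
      (hg.comp <| (Primrec.fst.comp Primrec.fst).pair <| Primrec.snd.pair <|
        Primrec.snd.comp <| Primrec.snd.comp Primrec.fst).to₂).to₂).of_eq fun a => ?_
  suffices ∀ o : Option γ, (l a).foldl (fun o b => o.bind fun c => g a c b) o =
      o.bind ((l a).foldlM (g a)) from this (some (f a))
  induction l a with
  | nil => simp
  | cons b l ih => intro o; cases o <;> simp [ih]

theorem primrec_list_filter {l : α → List β} {p : α → β → Prop} [∀ a b, Decidable (p a b)]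
    (hl : Primrec l) (hp : PrimrecRel p) : Primrec fun a => (l a).filter fun b => p a b :=
  (PrimrecRel.listFilter (R := fun b a => p a b) (hp.comp .snd .fst)).comp hl .id

theorem primrecPred_exists_mem {l : α → List β} {p : α → β → Prop} (hl : Primrec l)
    (hp : PrimrecRel p) : PrimrecPred fun a => ∃ b ∈ l a, p a b :=
  (PrimrecRel.exists_mem_list (R := fun b a => p a b) (hp.comp .snd .fst)).comp hl .id

theorem primrecPred_forall_mem {l : α → List β} {p : α → β → Prop} (hl : Primrec l)
    (hp : PrimrecRel p) : PrimrecPred fun a => ∀ b ∈ l a, p a b :=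
  (PrimrecRel.forall_mem_list (R := fun b a => p a b) (hp.comp .snd .fst)).comp hl .id

theorem primrecPred_exists_mem_option {o : α → Option β} {p : α → β → Prop} (ho : Primrec o)
    (hp : PrimrecRel p) : PrimrecPred fun a => ∃ b ∈ o a, p a b :=
  (primrecPred_exists_mem (primrec_option_elim (g := fun _ b => [b]) ho (.const [])
    (Primrec.list_cons.comp .snd (.const [])).to₂) hp).of_eq fun a => by cases o a <;> simp

theorem primrecPred_eq_true {f : α → Bool} (hf : Primrec f) : PrimrecPred fun a => f a = true :=
  Primrec.eq.comp hf (.const true)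

end PrimitiveRecursion

/-- The approximations to the transition function are uniformly primitive recursive. -/
def Transducer.IsPrimrec {σ : Type*} [Primcodable σ] (A : Transducer σ) : Prop :=
  Primrec fun p : ℕ × σ × Datum => A.next p.1 p.2.1 p.2.2

/-- The stages of the enumeration are uniformly primitive recursive. -/
def Enumeration.IsPrimrec {σ : Type*} [Primcodable σ] (E : Enumeration σ) : Prop :=
  Primrec fun p : ℕ × σ × ℕ => E.seen p.1 p.2.1 p.2.2

/-- Memories as triples. -/
def Memory.equivProd (σ : Type*) : Memory σ ≃ History σ × List Datum × ℕ where
  toFun m := (m.history, m.stored, m.bound)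
  invFun p := ⟨p.1, p.2.1, p.2.2⟩

instance (σ : Type*) [Primcodable σ] : Primcodable (Memory σ) :=
  Primcodable.ofEquiv _ (Memory.equivProd σ)

namespace Transducer

section Computability

variable {α σ : Type*} [Primcodable α] [Primcodable σ] {A : Transducer σ} {E : Enumeration σ}
  {k n N : α → ℕ} {q : α → σ} {R : α → List σ} {x : α → Datum} {h : α → History σ}
  {m : α → Memory σ}

theorem primrec_next (hA : A.IsPrimrec) (hk : Primrec k) (hq : Primrec q) (hx : Primrec x) :
    Primrec fun a => A.next (k a) (q a) (x a) :=
  hA.comp (hk.pair (hq.pair hx))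

theorem primrec_seen (hE : E.IsPrimrec) (hk : Primrec k) (hq : Primrec q) (hn : Primrec n) :
    Primrec fun a => E.seen (k a) (q a) (n a) :=
  hE.comp (hk.pair (hq.pair hn))

theorem primrecPred_knownAt (hA : A.IsPrimrec) (hk : Primrec k) (hR : Primrec R)
    (hx : Primrec x) : PrimrecPred fun a => A.KnownAt (k a) (R a) (x a) :=
  primrecPred_forall_mem hR (primrecPred_eq_true
    (Primrec.option_isSome.comp (primrec_next hA (hk.comp .fst) .snd (hx.comp .fst))))

theorem primrec_history : Primrec (Memory.history (σ := σ)) :=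
  Primrec.fst.comp (Primrec.of_equiv (e := Memory.equivProd σ))

theorem primrec_stored : Primrec (Memory.stored (σ := σ)) :=
  Primrec.fst.comp (Primrec.snd.comp (Primrec.of_equiv (e := Memory.equivProd σ)))

theorem primrec_bound : Primrec (Memory.bound (σ := σ)) :=
  Primrec.snd.comp (Primrec.snd.comp (Primrec.of_equiv (e := Memory.equivProd σ)))

theorem primrec_memory_mk {D : α → List Datum} (hh : Primrec h) (hD : Primrec D)
    (hN : Primrec N) : Primrec fun a => (⟨h a, D a, N a⟩ : Memory σ) :=
  (Primrec.of_equiv_symm (e := Memory.equivProd σ)).comp (hh.pair (hD.pair hN))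

variable [DecidableEq σ]

theorem primrec_exits (hA : A.IsPrimrec) (hk : Primrec k) (hR : Primrec R) (hx : Primrec x) :
    Primrec fun a => A.exits (k a) (R a) (x a) :=
  primrec_list_filter
    (Primrec.listFilterMap hR (primrec_next hA (hk.comp .fst) .snd (hx.comp .fst)))
    (primrecRel_mem.comp .snd (hR.comp .fst)).not

theorem primrec_absorb : Primrec₂ (History.absorb (σ := σ)) := by
  refine (Primrec.list_foldr (f := fun p : σ × List (List σ) => p.2) (g := fun _ => none)
    (h := fun p s => if p.1 ∈ s.1 then some s.1 else s.2.map (s.1 ++ ·)) .snd (.const none)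
    ?_).of_eq fun p => ?_
  · exact Primrec.ite (primrecRel_mem.comp (Primrec.fst.comp .fst) (Primrec.fst.comp .snd))
      (Primrec.option_some.comp (Primrec.fst.comp .snd))
      (Primrec.option_map (Primrec.snd.comp .snd)
        (Primrec.list_append.comp (Primrec.fst.comp (Primrec.snd.comp .fst)) .snd))
  · induction p.2 with
    | nil => rfl
    | cons R Rs ih => rw [List.foldr_cons, ih, History.absorb]

theorem primrec_push (hh : Primrec h) (hq : Primrec q) :
    Primrec fun a => (h a).push (q a) := by
  have hcomponents : Primrec fun a => (h a).components :=
    Primrec.list_cons.comp (Primrec.fst.comp hh) (Primrec.snd.comp hh)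
  exact (Primrec.option_getD.comp (primrec_absorb.comp hq hcomponents)
    (Primrec.list_cons.comp hq (.const []))).pair hcomponents

theorem primrec_feed (hA : A.IsPrimrec) (hk : Primrec k) (hh : Primrec h) (hx : Primrec x) :
    Primrec fun a => A.feed (k a) (h a) (x a) :=
  have hh₁ := Primrec.fst.comp hh
  Primrec.ite (primrecPred_knownAt hA hk hh₁ hx)
    (Primrec.option_some.comp (primrec_option_elim
      (Primrec.list_head?.comp (primrec_exits hA hk hh₁ hx)) hh
      (primrec_push (hh.comp .fst) .snd)))
    (.const none)

theorem primrecPred_closedAt (hA : A.IsPrimrec) (hk : Primrec k) (hR : Primrec R)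
    (hx : Primrec x) : PrimrecPred fun a => A.ClosedAt (k a) (R a) (x a) :=
  (primrecPred_knownAt hA hk hR hx).and (Primrec.eq.comp (primrec_exits hA hk hR hx) (.const []))

theorem primrec_tolerated (hA : A.IsPrimrec) (hE : E.IsPrimrec) (hh : Primrec h)
    (hN : Primrec N) : Primrec fun a => A.tolerated E (h a) (N a) := by
  have hh' : Primrec fun p : α × ℕ => h p.1 := hh.comp .fst
  have hN' : Primrec fun p : α × ℕ => N p.1 := hN.comp .fst
  have hx : Primrec fun p : α × ℕ => (some p.2 : Datum) := Primrec.option_some.comp .snd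
  refine Primrec.list_map (primrec_list_filter (Primrec.list_range.comp hN) ?_)
    (Primrec.option_some.comp .snd)
  refine PrimrecPred.and (primrecPred_exists_mem (Primrec.fst.comp hh') (primrecPred_eq_true
    (primrec_seen hE (hN'.comp .fst) .snd (Primrec.snd.comp .fst))))
    (PrimrecPred.and (PrimrecPred.not (Primrec.eq.comp (primrec_exits hA hN'
      (Primrec.fst.comp hh') hx) (.const []))) ?_)
  exact primrecPred_exists_mem (Primrec.snd.comp hh')
    (primrecPred_closedAt hA (hN'.comp .fst) .snd (hx.comp .fst))

theorem primrecPred_reveals (hA : A.IsPrimrec) (hE : E.IsPrimrec) (hm : Primrec m)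
    (hx : Primrec x) : PrimrecPred fun a => A.Reveals E (m a) (x a) := by
  have hh := primrec_history.comp hm
  have hmem {D : α → List Datum} (hD : Primrec D) :
      PrimrecPred fun p : α × Datum => p.2 ∈ D p.1 := primrecRel_mem.comp .snd (hD.comp .fst)
  exact primrecPred_exists_mem (primrec_tolerated hA hE hh (Primrec.encode.comp hx))
    ((hmem (primrec_tolerated hA hE hh (primrec_bound.comp hm))).not.and
      (hmem (primrec_stored.comp hm)).not)

theorem primrec_update (hA : A.IsPrimrec) (hE : E.IsPrimrec) {h₀ h₁ h₂ : α → History σ}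
    (hm : Primrec m) (hx : Primrec x) (hh₀ : Primrec h₀) (hh₁ : Primrec h₁) (hh₂ : Primrec h₂) :
    Primrec fun a => A.update E (m a) (x a) (h₀ a) (h₁ a) (h₂ a) := by
  have hh := primrec_history.comp hm
  have hD := primrec_stored.comp hm
  have hN := primrec_bound.comp hm
  have hxD := Primrec.list_cons.comp hx hD
  have hmem := primrecRel_mem.comp hx hD
  have hrev := primrecPred_reveals hA hE hm hx
  have heq {h' : α → History σ} (hh' : Primrec h') : PrimrecPred fun a => h' a = (m a).history :=
    Primrec.eq.comp hh' hh
  refine Primrec.ite ((heq hh₀).not.or (hmem.not.and (((heq hh₁).not.and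
    (primrecRel_mem.comp hx (primrec_tolerated hA hE hh hN)).not).or (hrev.and (heq hh₂).not))))
    (primrec_memory_mk hh₂ hxD (.const 0)) ?_
  refine Primrec.ite hmem hm (Primrec.ite hrev (primrec_memory_mk hh hxD (Primrec.encode.comp hx))
    (Primrec.ite (heq hh₁) hm (primrec_memory_mk hh hxD hN)))

theorem IsPrimrec.withMemory (hA : A.IsPrimrec) (hE : E.IsPrimrec) :
    (A.withMemory E).IsPrimrec := by
  have hk : Primrec fun p : ℕ × Memory σ × Datum => p.1 := .fst
  have hm : Primrec fun p : ℕ × Memory σ × Datum => p.2.1 := Primrec.fst.comp .snd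
  have hx : Primrec fun p : ℕ × Memory σ × Datum => p.2.2 := Primrec.snd.comp .snd
  have hh := primrec_history.comp hm
  refine Primrec.option_bind (primrec_feed hA hk hh (.const none)) (Primrec.option_bind
    (primrec_feed hA (hk.comp .fst) (hh.comp .fst) (hx.comp .fst)) (Primrec.option_map
      (primrec_foldlM (hh.comp (Primrec.fst.comp .fst)) ?_ ?_) ?_))
  · exact (Primrec.list_cons.comp (.const none) (Primrec.list_cons.comp hx
      (primrec_stored.comp hm))).comp (Primrec.fst.comp .fst)
  · exact primrec_feed hA (hk.comp (Primrec.fst.comp (Primrec.fst.comp .fst)))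
      (Primrec.fst.comp .snd) (Primrec.snd.comp .snd)
  · have hp : Primrec fun p : (((ℕ × Memory σ × Datum) × History σ) × History σ) × History σ =>
        p.1.1.1 := Primrec.fst.comp (Primrec.fst.comp .fst)
    exact primrec_update hA hE (hm.comp hp) (hx.comp hp) (Primrec.snd.comp (Primrec.fst.comp .fst))
      (Primrec.snd.comp .fst) .snd

end Computability

end Transducer

section Existence

variable {α β γ : Type*} [Primcodable α] [Primcodable β] [Primcodable γ]

/-- The languages semidecided by a code, as sections of its domain. -/
def codeEnumeration (α : Type*) [Encodable α] (c : Nat.Partrec.Code) : Enumeration α where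
  seen k a n := (c.evaln k (encode (a, n))).isSome
  seen_mono hk h := by
    obtain ⟨y, hy⟩ := Option.isSome_iff_exists.1 h
    exact Option.isSome_iff_exists.2 ⟨y, Nat.Partrec.Code.evaln_mono hk hy⟩

theorem mem_codeEnumeration {c : Nat.Partrec.Code} {a : α} {n : ℕ} :
    n ∈ (codeEnumeration α c).set a ↔ (c.eval (encode (a, n))).Dom := by
  simp only [Enumeration.set, codeEnumeration, Set.mem_ofPred_eq, Option.isSome_iff_exists,
    Part.dom_iff_mem, Nat.Partrec.Code.evaln_complete, Option.mem_def]
  exact exists_comm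

theorem primrec_codeEnumeration_seen {c : γ → Nat.Partrec.Code} {k : γ → ℕ} {a : γ → α}
    {n : γ → ℕ} (hc : Primrec c) (hk : Primrec k) (ha : Primrec a) (hn : Primrec n) :
    Primrec fun p => (codeEnumeration α (c p)).seen (k p) (a p) (n p) :=
  Primrec.option_isSome.comp (Nat.Partrec.Code.primrec_evaln.comp
    ((hk.pair hc).pair (Primrec.encode.comp (ha.pair hn))))

-- The recursion theorem lets the search refer to its own code.
theorem exists_code_search {P : Nat.Partrec.Code → α → β → Prop}
    (hP : PrimrecPred fun p : Nat.Partrec.Code × α × β => P p.1 p.2.1 p.2.2) :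
    ∃ c : Nat.Partrec.Code, ∀ a, (c.eval (encode a)).Dom ↔ ∃ b, P c a b := by
  classical
  have hQ : PrimrecPred fun p : (Nat.Partrec.Code × ℕ) × ℕ =>
      ∃ a ∈ decode (α := α) p.1.2, ∃ b ∈ decode (α := β) p.2, P p.1.1 a b :=
    primrecPred_exists_mem_option (Primrec.decode.comp (Primrec.snd.comp .fst))
      (primrecPred_exists_mem_option (Primrec.decode.comp (Primrec.snd.comp .fst))
        (hP.comp ((Primrec.fst.comp (Primrec.fst.comp (Primrec.fst.comp .fst))).pair
          ((Primrec.snd.comp .fst).pair .snd))))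
  obtain ⟨c, hc⟩ := Nat.Partrec.Code.fixed_point₂
    (f := fun c i => Nat.rfind fun j => Part.some <| decide <|
      ∃ a ∈ decode (α := α) i, ∃ b ∈ decode (α := β) j, P c a b)
    (Partrec.rfind (Computable.partrec hQ.decide.to_comp))
  refine ⟨c, fun a => ?_⟩
  rw [hc]
  refine Nat.rfind_dom.trans ?_
  simp only [encodek, Option.mem_some_iff, exists_eq_left', Part.mem_some_iff, true_eq_decide_iff,
    Part.some_dom, implies_true, and_true]
  exact ⟨fun ⟨_, b, _, hb⟩ => ⟨b, hb⟩, fun ⟨b, hb⟩ => ⟨encode b, b, encodek b, hb⟩⟩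

variable {μ : Type*} [Primcodable μ] [DecidableEq μ] {B : Transducer μ} {D : μ → List Datum}
  {G : Enumeration μ} {V : γ → Enumeration μ}

theorem primrec_approx (hD : Primrec D) (hG : G.IsPrimrec)
    (hV : Primrec fun p : γ × ℕ × μ × ℕ => (V p.1).seen p.2.1 p.2.2.1 p.2.2.2)
    {s : γ → ℕ} {m m₀ : γ → μ} (hs : Primrec s) (hm : Primrec m) (hm₀ : Primrec m₀) :
    Primrec fun p => approx D G (V p) (s p) (m p) (m₀ p) := by
  have hG' : Primrec fun p : γ × ℕ => G.seen (s p.1) (m p.1) p.2 :=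
    Transducer.primrec_seen hG (hs.comp .fst) (hm.comp .fst) .snd
  have hV' : Primrec fun p : γ × ℕ => (V p.1).seen (s p.1) (m₀ p.1) p.2 :=
    hV.comp (Primrec.fst.pair ((hs.comp .fst).pair ((hm₀.comp .fst).pair .snd)))
  have hseen : PrimrecRel fun p n => (if m₀ p = m p then G.seen (s p) (m p) n
      else (V p).seen (s p) (m₀ p) n) = true :=
    primrecPred_eq_true (Primrec.ite (Primrec.eq.comp (hm₀.comp .fst) (hm.comp .fst)) hG' hV')
  have hstored : Primrec fun p => (D (m p)).filterMap fun x => x :=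
    Primrec.listFilterMap (hD.comp hm) Primrec.snd.to₂
  exact (Primrec.list_append.comp hstored
    (primrec_list_filter (Primrec.list_range.comp hs) hseen)).of_eq fun p => by
      simp only [approx, List.reduceOption, id_def, Bool.decide_eq_true]

theorem primrecPred_enumeratesAt (hB : B.IsPrimrec) (hD : Primrec D) (hG : G.IsPrimrec)
    (hV : Primrec fun p : γ × ℕ × μ × ℕ => (V p.1).seen p.2.1 p.2.2.1 p.2.2.2)
    {m : γ → μ} {n s k : γ → ℕ} (hm : Primrec m) (hn : Primrec n) (hs : Primrec s)
    (hk : Primrec k) :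
    PrimrecPred fun p => EnumeratesAt B D G (V p) (m p) (n p) (s p) (k p) := by
  have hP : Primrec fun p : γ × μ => approx D G (V p.1) (s p.1) (m p.1) p.2 :=
    primrec_approx (V := fun p : γ × μ => V p.1) hD hG
      (hV.comp ((Primrec.fst.comp .fst).pair .snd)) (hs.comp .fst) (hm.comp .fst) .snd
  refine (primrecRel_mem.comp (Primrec.option_some.comp hn) (hD.comp hm)).or
    (primrecPred_exists_mem_option (Transducer.primrec_next hB hk hm (.const none)) ?_)
  refine (primrecRel_mem.comp (hn.comp .fst) hP).and (primrecPred_forall_mem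
    (Primrec.list_cons.comp (.const none) (Primrec.list_map hP (Primrec.option_some.comp .snd))) ?_)
  refine primrecPred_exists_mem_option (Transducer.primrec_next hB
    (hk.comp (Primrec.fst.comp .fst)) (hm.comp (Primrec.fst.comp .fst)) .snd) ?_
  have hp : Primrec fun q : ((γ × μ) × Datum) × μ => q.1.1.1 :=
    Primrec.fst.comp (Primrec.fst.comp .fst)
  have hseen : Primrec fun q : (((γ × μ) × Datum) × μ) × ℕ =>
      (V q.1.1.1.1).seen (k q.1.1.1.1) q.1.2 q.2 :=
    (hV.comp ((hp.comp .fst).pair ((hk.comp (hp.comp .fst)).pair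
      ((Primrec.snd.comp .fst).pair .snd))) :)
  exact (Primrec.eq.comp .snd (hm.comp hp)).or (primrecPred_forall_mem
    (hP.comp (Primrec.fst.comp .fst)) (primrecPred_eq_true hseen))

theorem exists_isTarget (hB : B.IsPrimrec) (hD : Primrec D) (hG : G.IsPrimrec) :
    ∃ c, IsTarget B D G (codeEnumeration μ c) := by
  obtain ⟨c, hc⟩ := exists_code_search
    (P := fun c (p : μ × ℕ) (q : ℕ × ℕ) =>
      EnumeratesAt B D G (codeEnumeration μ c) p.1 p.2 q.1 q.2)
    (primrecPred_enumeratesAt (V := fun p => codeEnumeration μ p.1) hB hD hG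
      (primrec_codeEnumeration_seen (Primrec.fst.comp .fst) (Primrec.fst.comp .snd)
        (Primrec.fst.comp (Primrec.snd.comp .snd)) (Primrec.snd.comp (Primrec.snd.comp .snd)))
      (Primrec.fst.comp (Primrec.fst.comp .snd)) (Primrec.snd.comp (Primrec.fst.comp .snd))
      (Primrec.fst.comp (Primrec.snd.comp .snd)) (Primrec.snd.comp (Primrec.snd.comp .snd)))
  refine ⟨c, fun m n => ?_⟩
  rw [mem_codeEnumeration, hc, Prod.exists, exists_enumeratesAt]

end Existence

section Conjectures

theorem IsTarget.set_eq {μ : Type*} [DecidableEq μ] {B : Transducer μ} {D : μ → List Datum}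
    {G V : Enumeration μ} {m : μ} {L : Set ℕ} (hV : IsTarget B D G V)
    (hD : ∀ n, some n ∈ D m → n ∈ L) (hG : B.Step m none m → G.set m = L)
    (hstep : ∀ x, Legal L x → ∃ m', B.Step m x m' ∧ (m' = m ∨ V.set m' = L)) : V.set m = L := by
  obtain ⟨m₀, hm₀, hcase⟩ := hstep none legal_none
  have happrox (n : ℕ) : (∃ s, n ∈ approx D G V s m m₀) ↔ n ∈ L := by
    by_cases heq : m₀ = m
    · subst heq
      rw [exists_mem_approx_self, hG hm₀, or_iff_right_of_imp (hD n)]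
    · rw [exists_mem_approx_of_ne heq, hcase.resolve_left heq, or_iff_right_of_imp (hD n)]
  ext n
  rw [hV]
  constructor
  · rintro (hn | ⟨s, m₁, hm₁, hn, -⟩)
    · exact hD n hn
    · exact (happrox n).1 ⟨s, hm₁.unique hm₀ ▸ hn⟩
  · intro hn
    obtain ⟨s, hs⟩ := (happrox n).2 hn
    have hsub (w) (hw : w ∈ approx D G V s m m₀) : w ∈ L := (happrox w).1 ⟨s, hw⟩
    refine Or.inr ⟨s, m₀, hm₀, hs, fun x hx => ?_⟩
    obtain ⟨m', hm', h⟩ := hstep x <| by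
      rcases List.mem_cons.1 hx with rfl | hx
      · exact legal_none
      · obtain ⟨l, hl, rfl⟩ := List.mem_map.1 hx
        exact legal_some.2 (hsub l hl)
    exact ⟨m', hm', h.imp_right fun (h : V.set m' = L) w hw => by rw [h]; exact hsub w hw⟩

variable {σ : Type*} {A : Transducer σ} {E : Enumeration σ} {L : Set ℕ} {m : Memory σ}

/-- The union of the conjectures of the states in the newest component. -/
def Enumeration.union (E : Enumeration σ) : Enumeration (Memory σ) where
  seen k m n := decide (∃ r ∈ m.history.1, E.seen k r n)
  seen_mono hk h := by
    simp only [decide_eq_true_eq] at h ⊢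
    exact h.imp fun r => And.imp_right (E.seen_mono hk)

theorem mem_union_set {n : ℕ} : n ∈ E.union.set m ↔ ∃ r ∈ m.history.1, n ∈ E.set r := by
  simp only [Enumeration.set, Enumeration.union, decide_eq_true_eq, Set.mem_ofPred_eq]
  exact ⟨fun ⟨k, r, hr, h⟩ => ⟨r, hr, k, h⟩, fun ⟨r, hr, k, h⟩ => ⟨k, r, hr, h⟩⟩

theorem Enumeration.IsPrimrec.union [Primcodable σ] (hE : E.IsPrimrec) : E.union.IsPrimrec := by
  have hseen : Primrec fun p : (ℕ × Memory σ × ℕ) × σ => E.seen p.1.1 p.2 p.1.2.2 :=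
    Transducer.primrec_seen hE (Primrec.fst.comp .fst) .snd
      (Primrec.snd.comp (Primrec.snd.comp .fst))
  have hstates : Primrec fun p : ℕ × Memory σ × ℕ => p.2.1.history.1 :=
    Primrec.fst.comp (Transducer.primrec_history.comp (Primrec.fst.comp .snd))
  have hexists : PrimrecPred fun p : ℕ × Memory σ × ℕ =>
      ∃ r ∈ p.2.1.history.1, E.seen p.1 r p.2.2 = true :=
    primrecPred_exists_mem hstates (primrecPred_eq_true hseen)
  exact hexists.decide

variable [DecidableEq σ]

theorem Transducer.Settled.union_set_eq (hA : A.Identifies E.set L) (hs : A.Settled E L m)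
    (hm : A.Transition E m none m) : E.union.set m = L := by
  have hset (r) (hr : r ∈ m.history.1) : E.set r = L := hs.set_eq hA (hm.none_closed rfl) hr
  obtain ⟨r, hr⟩ := List.exists_mem_of_ne_nil _ hs.valid.nonempty
  ext n
  rw [mem_union_set]
  exact ⟨fun ⟨r, hr, hn⟩ => hset r hr ▸ hn, fun hn => ⟨r, hr, (hset r hr).symm ▸ hn⟩⟩

theorem Transducer.Settled.target_eq {V : Enumeration (Memory σ)} (hA : A.Identifies E.set L)
    (hV : IsTarget (A.withMemory E) Memory.stored E.union V) (hs : A.Settled E L m) :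
    V.set m = L := by
  induction hs.acc hA with
  | intro m _ ih =>
    refine hV.set_eq (fun n hn => legal_some.1 (hs.valid.legal _ hn))
      (fun h => hs.union_set_eq hA (transition_of_step h)) fun x hx => ?_
    obtain ⟨m', hm'⟩ := hs.valid.exists_step (E := E) hA hx
    have ht := transition_of_step hm'
    exact ⟨m', hm', or_iff_not_imp_left.2 fun hne =>
      ih m' ⟨hne, x, hx, ht⟩ (hs.transition hA hx ht)⟩

end Conjectures

/-! ### Learners and transducers -/

namespace Transducer

variable {σ : Type*} {A : Transducer σ}

/-- The partial transition function approximated by `next`. -/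
def move (A : Transducer σ) (p : σ × Datum) : Part σ := Nat.rfindOpt fun k => A.next k p.1 p.2

theorem Step.mem_move {r r' : σ} {x : Datum} (h : A.Step r x r') : r' ∈ A.move (r, x) :=
  (Nat.rfindOpt_mono fun hk h => A.next_mono hk h).2 h

end Transducer

section Learners

variable {α β γ σ : Type*} [Primcodable α] [Primcodable β] [Primcodable σ]

theorem exists_code_of_partrec {f : α →. β} (hf : Partrec f) :
    ∃ c : Nat.Partrec.Code, ∀ a, c.eval (encode a) = (f a).map encode := by
  obtain ⟨c, hc⟩ := Nat.Partrec.Code.exists_code.1 hf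
  exact ⟨c, fun a => by simp [hc]⟩

theorem exists_codeEnumeration {f : α × ℕ →. β} (hf : Partrec f) :
    ∃ c, ∀ a, (codeEnumeration α c).set a = {n | (f (a, n)).Dom} := by
  obtain ⟨c, hc⟩ := exists_code_of_partrec hf
  refine ⟨c, fun a => Set.ext fun n => ?_⟩
  rw [mem_codeEnumeration, hc]
  rfl

theorem isPrimrec_codeEnumeration (c : Nat.Partrec.Code) : (codeEnumeration α c).IsPrimrec :=
  primrec_codeEnumeration_seen (.const c) .fst (Primrec.fst.comp .snd) (Primrec.snd.comp .snd)

theorem IsAcceptable.exists_index {φ : ℕ → ℕ →. ℕ} (hφ : IsAcceptable φ) (c : Nat.Partrec.Code) :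
    ∃ f : α → ℕ, Computable f ∧ ∀ a, W φ (f a) = (codeEnumeration α c).set a := by
  obtain ⟨f, hf, hfc⟩ := hφ.translate (fun p x => c.eval (Nat.pair p x))
    (Nat.Partrec.Code.eval_part.comp (Computable.const c) Primrec₂.natPair.to_comp)
  refine ⟨f ∘ encode, hf.comp .encode, fun a => Set.ext fun n => ?_⟩
  simp only [W, Function.comp_apply, mem_codeEnumeration, PFun.mem_dom, hfc, Part.dom_iff_mem,
    encode_prod_val, encode_nat]

theorem exists_transducer {f : σ × Datum →. σ} (hf : Partrec f) (q₀ : σ) :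
    ∃ A : Transducer σ, A.IsPrimrec ∧ A.start = q₀ ∧ ∀ q x q', A.Step q x q' ↔ q' ∈ f (q, x) := by
  obtain ⟨c, hc⟩ := exists_code_of_partrec hf
  refine ⟨⟨q₀, fun k q x => (c.evaln k (encode (q, x))).bind decode, fun hk h => ?_⟩, ?_, rfl,
    fun q x q' => ?_⟩
  · obtain ⟨y, hy, hq⟩ := Option.bind_eq_some_iff.1 h
    exact Option.bind_eq_some_iff.2 ⟨y, Nat.Partrec.Code.evaln_mono hk hy, hq⟩
  · exact Primrec.option_bind (Nat.Partrec.Code.primrec_evaln.comp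
      ((Primrec.fst.pair (.const c)).pair (Primrec.encode.comp .snd)))
      (Primrec.decode.comp .snd).to₂
  · have hmem (y : ℕ) :
        (∃ k, c.evaln k (encode (q, x)) = some y) ↔ ∃ r ∈ f (q, x), encode r = y := by
      rw [← Part.mem_map_iff, ← hc]
      exact Nat.Partrec.Code.evaln_complete.symm
    simp only [Transducer.Step, Option.bind_eq_some_iff]
    constructor
    · rintro ⟨k, y, hy, hq'⟩
      obtain ⟨r, hr, rfl⟩ := (hmem y).1 ⟨k, hy⟩
      rw [encodek, Option.some_inj] at hq'
      exact hq' ▸ hr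
    · intro hq'
      obtain ⟨k, hk⟩ := (hmem _).2 ⟨q', hq', rfl⟩
      exact ⟨k, _, hk, encodek q'⟩

theorem finite_range_of_eventually_eq {f : ℕ → γ} {b : γ} (h : ∀ᶠ t in atTop, f t = b) :
    (Set.range f).Finite := by
  obtain ⟨n, hn⟩ := eventually_atTop.1 h
  refine (((Set.finite_Iio n).image f).insert b).subset (Set.range_subset_iff.2 fun t => ?_)
  rcases lt_or_ge t n with ht | ht
  exacts [Or.inr ⟨t, ht, rfl⟩, Or.inl (hn t ht)]

namespace BMSLearner

variable {M : BMSLearner} {T : ℕ → Datum} {a : ℕ → ℕ} {h : ℕ → Hyp}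

/-- On the text `T`, the learner passes through the memory states `a` and outputs `h`. -/
def Computes (M : BMSLearner) (T : ℕ → Datum) (a : ℕ → ℕ) (h : ℕ → Hyp) : Prop :=
  a 0 = 0 ∧ h 0 = none ∧ ∀ t, a (t + 1) ∈ M.s (a t, T t) ∧ h (t + 1) ∈ M.h (a t, T t)

theorem Computes.sStar_initSeg (hM : M.Computes T a h) (t : ℕ) :
    M.sStar (initSeg T t) = Part.some (a t) := by
  induction t with
  | zero => exact congrArg Part.some hM.1.symm
  | succ t ih =>
    rw [initSeg_succ, sStar_concat, ih, Part.bind_some]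
    exact Part.eq_some_iff.2 (hM.2.2 t).1

theorem Computes.isLearningSeq (hM : M.Computes T a h) : M.IsLearningSeq T h := by
  rintro (_ | t)
  · exact congrArg Part.some hM.2.1.symm
  · rw [initSeg_succ, hStar_concat, hM.sStar_initSeg, Part.bind_some]
    exact Part.eq_some_iff.2 (hM.2.2 t).2

theorem Computes.usesFinitelyManyStates_iff (hM : M.Computes T a h) :
    M.UsesFinitelyManyStates T ↔ (Set.range a).Finite := by
  simp only [UsesFinitelyManyStates, hM.sStar_initSeg, Part.mem_some_iff, Set.range, eq_comm]

theorem IsLearningSeq.exists_computes (hh : M.IsLearningSeq T h) : ∃ a, M.Computes T a h := by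
  have hstep (t : ℕ) : ∃ b ∈ M.sStar (initSeg T t), h (t + 1) ∈ M.h (b, T t) := by
    rw [← Part.mem_bind_iff, ← hStar_concat, ← initSeg_succ, hh]
    exact Part.mem_some _
  choose a ha hha using hstep
  refine ⟨a, Part.mem_some_iff.1 (ha 0), (Part.some_inj.1 (hh 0)).symm, fun t => ⟨?_, hha t⟩⟩
  simpa [initSeg_succ, sStar_concat, Part.eq_some_iff.2 (ha t)] using ha (t + 1)

end BMSLearner

/-- The latest proper hypothesis among the first terms of a learning sequence, or `0` if there is
none. -/
def latest (h : ℕ → Hyp) : ℕ → ℕ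
  | 0 => (h 0).getD 0
  | t + 1 => (h (t + 1)).getD (latest h t)

theorem Ex.eventually_latest_eq {V : ℕ → Set ℕ} {h : ℕ → Hyp} {T : ℕ → Datum} (hE : Ex V h T) :
    ∃ p, V p = content T ∧ ∀ᶠ t in atTop, latest h t = p := by
  obtain ⟨t₀, p, hp, hV, hconst⟩ := hE
  refine ⟨p, hV, eventually_atTop.2 ⟨t₀, fun t ht => ?_⟩⟩
  induction t, ht using Nat.le_induction with
  | base => cases t₀ <;> simp [latest, hp]
  | succ t ht ih =>
    by_cases hnone : h (t + 1) = none
    · simp [latest, hnone, ih]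
    · simp [latest, hconst (t + 1) (ht.trans t.le_succ) hnone, hp]

/-- The hypotheses given by the entries of `q` after the first one, which stands for the start
state and comes with no hypothesis. -/
def announce (o : γ → ℕ) (q : ℕ → γ) (t : ℕ) : Hyp := if t = 0 then none else some (o (q t))

theorem apply_eq_of_announce_eq_some {o : γ → ℕ} {q : ℕ → γ} {t p : ℕ}
    (h : announce o q t = some p) : o (q t) = p := by
  unfold announce at h
  split_ifs at h
  exact Option.some_inj.1 h

theorem ex_announce {V : ℕ → Set ℕ} {o : γ → ℕ} {q : ℕ → γ} {r : γ} {T : ℕ → Datum}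
    (hq : ∀ᶠ t in atTop, q t = r) (hV : V (o r) = content T) : Ex V (announce o q) T := by
  obtain ⟨n, hn⟩ := eventually_atTop.1 hq
  have hconst (t : ℕ) (ht : n + 1 ≤ t) : announce o q t = some (o r) := by
    simp [announce, hn t (by omega), show t ≠ 0 by omega]
  exact ⟨n + 1, o r, hconst _ le_rfl, hV, fun t ht _ => (hconst t ht).trans (hconst _ le_rfl).symm⟩

theorem BMSLearner.exists_transducer_isPath (M : BMSLearner) : ∃ A : Transducer (ℕ × ℕ),
    A.IsPrimrec ∧ ∀ {T a h}, M.Computes T a h → A.IsPath T fun t => (a t, latest h t) := by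
  have hin : Computable fun p : (ℕ × ℕ) × Datum => (p.1.1, p.2) :=
    (Computable.fst.comp .fst).pair .snd
  have hout : Computable fun p : (((ℕ × ℕ) × Datum) × ℕ) × Hyp => (p.1.2, p.2.getD p.1.1.1.2) :=
    (Computable.snd.comp .fst).pair (Computable.option_getD .snd
      (Computable.snd.comp (Computable.fst.comp (Computable.fst.comp .fst))))
  obtain ⟨A, hA, hstart, hstep⟩ := exists_transducer ((M.partrec_s.comp hin).bind
    (((M.partrec_h.comp hin).comp .fst).map hout.to₂).to₂) (0, 0)
  refine ⟨A, hA, fun {T a h} hM => ⟨?_, fun t => (hstep _ _ _).2 ?_⟩⟩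
  · simp [hstart, hM.1, latest, hM.2.1]
  · exact Part.mem_bind_iff.2 ⟨a (t + 1), (hM.2.2 t).1,
      (Part.mem_map_iff _).2 ⟨h (t + 1), (hM.2.2 t).2, rfl⟩⟩

namespace Transducer

variable {A : Transducer σ} {o : σ → ℕ} {T : ℕ → Datum} {q : ℕ → σ}

theorem IsPrimrec.partrec_move (hA : A.IsPrimrec) : Partrec A.move :=
  Partrec.rfindOpt (primrec_next hA .snd (Primrec.fst.comp .fst) (Primrec.snd.comp .fst)).to_comp

/-- The state encoded by a number; `0` is the code of the start state. -/
def stateOfNat (A : Transducer σ) (n : ℕ) : σ := ((decode (α := Option σ) n).getD none).getD A.start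

theorem stateOfNat_zero : A.stateOfNat 0 = A.start := by
  have hdecode : decode (α := Option σ) 0 = some none := encodek none
  simp [stateOfNat, hdecode]

/-- The learner simulating a transducer which outputs `o q` when entering the state `q`. -/
def toLearner (hA : A.IsPrimrec) (ho : Computable o) : BMSLearner :=
  have hmove : Partrec fun p : ℕ × Datum => A.move (A.stateOfNat p.1, p.2) :=
    hA.partrec_move.comp ((Computable.option_getD (Computable.option_getD
      (Computable.decode.comp .fst) (.const none)) (.const A.start)).pair .snd)
  { h := fun p => (A.move (A.stateOfNat p.1, p.2)).map fun q => some (o q)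
    s := fun p => (A.move (A.stateOfNat p.1, p.2)).map fun q => encode (some q)
    partrec_h := hmove.map ((Computable.option_some.comp ho).comp .snd).to₂
    partrec_s := hmove.map (Computable.encode.comp (Computable.option_some.comp .snd)).to₂
    dom_eq := rfl }

theorem IsPath.computes_toLearner (hA : A.IsPrimrec) (ho : Computable o) (hq : A.IsPath T q) :
    (toLearner hA ho).Computes T (fun t => if t = 0 then 0 else encode (some (q t)))
      (announce o q) := by
  refine ⟨rfl, rfl, fun t => ?_⟩
  have hstate : A.stateOfNat (if t = 0 then 0 else encode (some (q t))) = q t := by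
    split_ifs with ht
    · rw [stateOfNat_zero, ht, hq.1]
    · simp [stateOfNat]
  have hmove := (hq.2 t).mem_move
  simp only [toLearner, announce, hstate, Nat.add_eq_zero_iff, one_ne_zero, and_false, if_false]
  exact ⟨Part.mem_map _ hmove, Part.mem_map _ hmove⟩

theorem IsPath.usesFinitelyManyStates_toLearner (hA : A.IsPrimrec) (ho : Computable o)
    (hq : A.IsPath T q) (hfin : (Set.range q).Finite) :
    (toLearner hA ho).UsesFinitelyManyStates T := by
  refine (hq.computes_toLearner hA ho).usesFinitelyManyStates_iff.2 <|
    ((hfin.image fun r => encode (some r)).insert 0).subset (Set.range_subset_iff.2 fun t => ?_)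
  split_ifs
  exacts [Set.mem_insert 0 _, Or.inr ⟨q t, ⟨t, rfl⟩, rfl⟩]

end Transducer

end Learners

/-! ### Learning under restrictions -/

section Restrictions

variable {φ : ℕ → ℕ →. ℕ} {V : ℕ → Set ℕ} {L : Set ℕ} {h : ℕ → Hyp} {T : ℕ → Datum}
  {δ δ' : Restriction}

theorem BMSLearner.exists_identifies (M : BMSLearner) (V : ℕ → Set ℕ) :
    ∃ A : Transducer (ℕ × ℕ), A.IsPrimrec ∧ ∀ L, (∀ T, IsText T L → M.UsesFinitelyManyStates T ∧
      ∃ h, M.IsLearningSeq T h ∧ Ex V h T) → A.Identifies (fun q => V q.2) L := by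
  obtain ⟨A, hA, hpath⟩ := M.exists_transducer_isPath
  refine ⟨A, hA, fun L hM T hT => ?_⟩
  obtain ⟨hfin, h, hh, hE⟩ := hM T hT
  obtain ⟨a, ha⟩ := hh.exists_computes
  obtain ⟨p, hp, hlatest⟩ := hE.eventually_latest_eq
  refine ⟨_, hpath ha, ((ha.usesFinitelyManyStates_iff.1 hfin).prod
    (finite_range_of_eventually_eq hlatest)).subset ?_, ?_⟩
  · exact Set.range_subset_iff.2 fun t => ⟨⟨t, rfl⟩, ⟨t, rfl⟩⟩
  · filter_upwards [hlatest] with t ht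
    rw [ht, hp, hT]

/-- A hypothesis contains every earlier one, or a datum seen in between refutes the earlier one and
belongs to all later ones. -/
def MonOrRefuted : Restriction := fun V h T =>
  ∀ s t, s ≤ t → ∀ a b, h s = some a → h t = some b → V a ⊆ V b ∨
    ∃ n ∈ seqContent (initSeg T t), n ∉ V a ∧ ∀ u c, t ≤ u → h u = some c → n ∈ V c

theorem MonOrRefuted.wMon (H : MonOrRefuted V h T) : WMon V h T :=
  fun s t hst a b ha hb hsub =>
    (H s t hst a b ha hb).resolve_right fun ⟨_, hseen, hn, _⟩ => hn (hsub hseen)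

theorem MonOrRefuted.caut (H : MonOrRefuted V h T) : Caut V h T := by
  intro s t hst a b ha hb hsub
  rcases H s t hst a b ha hb with hle | ⟨n, -, hn, hlater⟩
  · exact hsub.not_subset hle
  · exact hn (hsub.subset (hlater t b le_rfl hb))

theorem MonOrRefuted.dec (H : MonOrRefuted V h T) : Dec V h T := by
  intro r s t hrs hst a b c ha hb hc hac
  rcases H r s hrs a b ha hb with hab | ⟨n, -, hn, hlater⟩
  · rcases H s t hst b c hb hc with hbc | ⟨n, -, hn, hlater⟩
    · exact hab.antisymm (hac ▸ hbc)
    · exact absurd (hab (hac ▸ hlater t c le_rfl hc)) hn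
  · exact absurd (hac ▸ hlater t c hst hc) hn

theorem Dec.nU (H : Dec V h T) : NU V h T :=
  fun r s t hrs hst a b c ha hb hc hac _ => H r s t hrs hst a b c ha hb hc hac

theorem SMon.mon (H : SMon V h T) : Mon V h T :=
  fun s t hst a b ha hb => Set.inter_subset_inter_left _ (H s t hst a b ha hb)

theorem txtBMSStarEx_mono (hδ : ∀ {h T}, δ (W φ) h T → δ' (W φ) h T) :
    TxtBMSStarEx φ δ ⊆ TxtBMSStarEx φ δ' :=
  fun _ ⟨hC, M, hM⟩ => ⟨hC, M, fun L hL T hT => (hM L hL T hT).imp_right fun ⟨h, hh, H, hE⟩ =>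
    ⟨h, hh, hδ H, hE⟩⟩

theorem txtBMSStarEx_subset_noRestriction :
    TxtBMSStarEx φ δ ⊆ TxtBMSStarEx φ NoRestriction :=
  txtBMSStarEx_mono fun _ => trivial

section Paths

variable {μ : Type*} {B : Transducer μ} {D : μ → List Datum} {G V : Enumeration μ} {m : ℕ → μ}
  {s t : ℕ}

theorem IsTarget.subset_or_stored_of_isPath [DecidableEq μ] (hV : IsTarget B D G V)
    (hm : B.IsPath T m) (hD : ∀ t, m (t + 1) = m t ∨ D (m (t + 1)) = T t :: D (m t))
    (hst : s ≤ t) :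
    V.set (m s) ⊆ V.set (m t) ∨
      ∃ n ∈ seqContent (initSeg T t), n ∉ V.set (m s) ∧ some n ∈ D (m t) := by
  induction t, hst using Nat.le_induction with
  | base => exact Or.inl subset_rfl
  | succ t _ ih =>
    rcases ih with hsub | ⟨n, hseen, hn, hmem⟩
    · refine (hV.subset_or_stored (hm.2 t) (hD t)).imp hsub.trans ?_
      rintro ⟨n, hx, hn, hmem⟩
      exact ⟨n, by simp [seqContent, initSeg_succ, hx], fun h => hn (hsub h), hmem⟩
    · exact Or.inr ⟨n, (initSeg_prefix T t.le_succ).subset hseen, hn,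
        stored_subset_of_le hD t.le_succ hmem⟩

end Paths

theorem noRestriction_subset_monOrRefuted (hφ : IsAcceptable φ) :
    TxtBMSStarEx φ NoRestriction ⊆ TxtBMSStarEx φ MonOrRefuted := by
  rintro C ⟨hC, M, hM⟩
  obtain ⟨A, hA, hAL⟩ := M.exists_identifies (W φ)
  obtain ⟨e, he⟩ := exists_codeEnumeration (f := fun p : (ℕ × ℕ) × ℕ => φ p.1.2 p.2)
    (hφ.partrec.comp (Computable.snd.comp .fst) .snd)
  have hE := isPrimrec_codeEnumeration (α := ℕ × ℕ) e
  have hB := hA.withMemory hE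
  obtain ⟨c, hc⟩ := exists_isTarget hB Transducer.primrec_stored hE.union
  obtain ⟨f, hf, hfc⟩ := hφ.exists_index (α := Memory (ℕ × ℕ)) c
  refine ⟨hC, Transducer.toLearner hB hf, fun L hL T hT => ?_⟩
  have hid : A.Identifies (codeEnumeration (ℕ × ℕ) e).set L := by
    rw [show (codeEnumeration (ℕ × ℕ) e).set = fun q => W φ q.2 from funext he]
    exact hAL L fun T hT => (hM L hL T hT).imp_right fun ⟨h, hh, _, hE⟩ => ⟨h, hh, hE⟩
  obtain ⟨m, hm, m₀, hsettled, hconv⟩ := Transducer.exists_settled_path hid hT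
  have hconv := eventually_atTop.2 hconv
  have hstored (t : ℕ) : m (t + 1) = m t ∨ (m (t + 1)).stored = T t :: (m t).stored :=
    (Transducer.transition_of_step (hm.2 t)).stored_eq
  refine ⟨hm.usesFinitelyManyStates_toLearner hB hf (finite_range_of_eventually_eq hconv), _,
    (hm.computes_toLearner hB hf).isLearningSeq, ?_, ex_announce hconv ?_⟩
  · intro s t hst a b ha hb
    obtain rfl := apply_eq_of_announce_eq_some ha
    obtain rfl := apply_eq_of_announce_eq_some hb
    rw [hfc, hfc]
    refine (hc.subset_or_stored_of_isPath hm hstored hst).imp_right ?_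
    rintro ⟨n, hseen, hn, hmem⟩
    refine ⟨n, hseen, hn, fun u p htu hu => ?_⟩
    obtain rfl := apply_eq_of_announce_eq_some hu
    rw [hfc]
    exact (hc _ _).2 (Or.inl (stored_subset_of_le hstored htu hmem))
  · rw [hfc, hsettled.target_eq hid hc, hT]

theorem txtBMSStarEx_eq_noRestriction (hφ : IsAcceptable φ)
    (hδ : ∀ {h T}, MonOrRefuted (W φ) h T → δ (W φ) h T) :
    TxtBMSStarEx φ δ = TxtBMSStarEx φ NoRestriction :=
  txtBMSStarEx_subset_noRestriction.antisymm
    ((noRestriction_subset_monOrRefuted hφ).trans (txtBMSStarEx_mono hδ))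

end Restrictions

/-! ### Separation -/

section Separation

variable {φ : ℕ → ℕ →. ℕ} {l l' : List ℕ} {n t : ℕ} {T T' : ℕ → Datum} {x : Datum} {L : Set ℕ}

/-- For a list `l` of odd numbers: the members of `l`, their predecessors, and the even numbers
below all members of `l`. -/
def lang (l : List ℕ) : Set ℕ := {x | x ∈ l ∨ x + 1 ∈ l ∨ Even x ∧ ∀ n ∈ l, x < n}

/-- The lists of odd numbers; their languages separate learning from monotonic learning. -/
def oddLists : Set (List ℕ) := {l | ∀ n ∈ l, Odd n}

/-- The lists of at most one odd number; their languages separate monotonic from strongly monotonic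
learning. -/
def shortOddLists : Set (List ℕ) := {l | l.length ≤ 1 ∧ l ∈ oddLists}

theorem lang_congr (h : ∀ n, n ∈ l ↔ n ∈ l') : lang l = lang l' := by
  simp only [lang, h]

theorem mem_lang_of_odd (hl : l ∈ oddLists) (hn : Odd n) : n ∈ lang l ↔ n ∈ l := by
  refine ⟨?_, Or.inl⟩
  rintro (h | h | ⟨h, -⟩)
  · exact h
  · exact absurd hn.add_one (Nat.not_even_iff_odd.2 (hl _ h))
  · exact absurd hn (Nat.not_odd_iff_even.2 h)

theorem lang_nil : lang [] = {x | Even x} := by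
  ext x
  simp [lang]

theorem succ_mem_lang_nil (hn : Odd n) : n + 1 ∈ lang [] := by
  rw [lang_nil]
  exact hn.add_one

theorem succ_notMem_lang_singleton (n : ℕ) : n + 1 ∉ lang [n] := by
  simp only [lang, List.mem_singleton, forall_eq, Set.mem_ofPred_eq]
  omega

theorem lang_singleton_subset (n : ℕ) : lang [n] ⊆ lang [n, n + 2] := by
  rintro x (h | h | ⟨heven, hlt⟩)
  · exact Or.inl (List.mem_cons.2 (Or.inl (List.mem_singleton.1 h)))
  · exact Or.inr (Or.inl (List.mem_cons.2 (Or.inl (List.mem_singleton.1 h))))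
  · have := hlt n (List.mem_singleton_self n)
    exact Or.inr (Or.inr ⟨heven, by simp; omega⟩)

theorem primrecPred_mem_lang : PrimrecPred fun p : List ℕ × ℕ => p.2 ∈ lang p.1 := by
  have heven : PrimrecPred fun p : List ℕ × ℕ => Even p.2 :=
    (Primrec.eq.comp (Primrec.nat_mod.comp .snd (.const 2)) (.const 0)).of_eq
      fun p => Nat.even_iff.symm
  exact (primrecRel_mem.comp .snd .fst).or ((primrecRel_mem.comp (Primrec.succ.comp .snd) .fst).or
    (heven.and (primrecPred_forall_mem .fst (Primrec.nat_lt.comp (Primrec.snd.comp .fst) .snd))))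

theorem rePred_mem_lang (l : List ℕ) : REPred fun n => n ∈ lang l :=
  (primrecPred_mem_lang.comp ((Primrec.const l).pair .id)).computablePred.to_re

theorem exists_lang_index (hφ : IsAcceptable φ) :
    ∃ f : List ℕ → ℕ, Computable f ∧ ∀ l, W φ (f l) = lang l := by
  obtain ⟨c, hc⟩ := exists_codeEnumeration primrecPred_mem_lang.computablePred.to_re
  obtain ⟨f, hf, hfc⟩ := hφ.exists_index (α := List ℕ) c
  refine ⟨f, hf, fun l => ?_⟩
  rw [hfc, hc]
  simp [Part.assert]

/-- The list of odd data after reading one more datum. -/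
def record (l : List ℕ) : Datum → List ℕ
  | none => l
  | some n => if Odd n ∧ n ∉ l then n :: l else l

theorem primrec_record : Primrec₂ record := by
  have hodd : PrimrecPred fun p : (List ℕ × Datum) × ℕ => Odd p.2 :=
    (Primrec.eq.comp (Primrec.nat_mod.comp .snd (.const 2)) (.const 1)).of_eq
      fun p => Nat.odd_iff.symm
  have hl : Primrec fun p : (List ℕ × Datum) × ℕ => p.1.1 := Primrec.fst.comp .fst
  refine (primrec_option_elim .snd .fst (Primrec.ite (hodd.and (primrecRel_mem.comp .snd hl).not)
    (Primrec.list_cons.comp .snd hl) hl).to₂).of_eq ?_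
  rintro ⟨l, _ | n⟩ <;> rfl

theorem mem_record : n ∈ record l x ↔ n ∈ l ∨ Odd n ∧ x = some n := by
  rcases x with _ | m
  · simp [record]
  · rw [record, Option.some_inj]
    split_ifs <;> grind

theorem record_eq_self (h : ∀ n, Odd n → x = some n → n ∈ l) : record l x = l := by
  rcases x with _ | m
  · rfl
  · exact if_neg fun hm => hm.2 (h m hm.1 rfl)

/-- The odd data among the first `t` entries of a text. -/
def recorded (T : ℕ → Datum) : ℕ → List ℕ
  | 0 => []
  | t + 1 => record (recorded T t) (T t)

theorem mem_recorded : n ∈ recorded T t ↔ Odd n ∧ some n ∈ initSeg T t := by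
  induction t with
  | zero => simp [recorded]
  | succ t ih =>
    rw [recorded, mem_record, ih, initSeg_succ, List.mem_append, List.mem_singleton, and_or_left,
      eq_comm (a := T t)]

theorem recorded_subset_of_le {s : ℕ} (hst : s ≤ t) : recorded T s ⊆ recorded T t :=
  fun _ hn => mem_recorded.2 ⟨(mem_recorded.1 hn).1,
    (initSeg_prefix T hst).subset (mem_recorded.1 hn).2⟩

theorem recorded_subset (hl : l ∈ oddLists) (hT : IsText T (lang l)) : recorded T t ⊆ l := by
  intro n hn
  rw [mem_recorded] at hn
  exact (mem_lang_of_odd hl hn.1).1 (hT ▸ mem_content_iff.2 ⟨t, hn.2⟩)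

theorem eventually_subset_recorded (hl : l ∈ oddLists) (hT : IsText T (lang l)) :
    ∀ᶠ t in atTop, l ⊆ recorded T t := by
  refine (eventually_all_finite (List.finite_toSet l)).2 fun n hn => ?_
  have hmem : n ∈ content T := hT ▸ Or.inl hn
  obtain ⟨t, ht⟩ := mem_content_iff.1 hmem
  exact eventually_atTop.2
    ⟨t, fun u htu => recorded_subset_of_le htu (mem_recorded.2 ⟨hl n hn, ht⟩)⟩

theorem exists_eventually_recorded_eq (hl : l ∈ oddLists) (hT : IsText T (lang l)) :
    ∃ r, lang r = lang l ∧ ∀ᶠ t in atTop, recorded T t = r := by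
  obtain ⟨t₀, ht₀⟩ := eventually_atTop.1 (eventually_subset_recorded hl hT)
  refine ⟨recorded T t₀, lang_congr fun n => ⟨fun hn => recorded_subset hl hT hn,
    fun hn => ht₀ t₀ le_rfl hn⟩, eventually_atTop.2 ⟨t₀, fun t ht => ?_⟩⟩
  induction t, ht using Nat.le_induction with
  | base => rfl
  | succ t ht ih =>
    rw [recorded, record_eq_self, ih]
    exact fun n hn hx => ht₀ t ht ((mem_lang_of_odd hl hn).1 (hT ▸ ⟨t, hx⟩))

theorem image_lang_mem_txtBMSStarEx {δ : Restriction} {S : Set (List ℕ)} (hφ : IsAcceptable φ)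
    (hS : S ⊆ oddLists) (hδ : ∀ f, (∀ l, W φ (f l) = lang l) → ∀ l ∈ S, ∀ T, IsText T (lang l) →
      δ (W φ) (announce f (recorded T)) T) :
    lang '' S ∈ TxtBMSStarEx φ δ := by
  obtain ⟨f, hf, hfl⟩ := exists_lang_index hφ
  let A : Transducer (List ℕ) := ⟨[], fun _ l x => some (record l x), fun _ h => h⟩
  have hA : A.IsPrimrec := Primrec.option_some.comp (primrec_record.comp
    (Primrec.fst.comp .snd) (Primrec.snd.comp .snd))
  have hpath (T : ℕ → Datum) : A.IsPath T (recorded T) := ⟨rfl, fun t => ⟨0, rfl⟩⟩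
  refine ⟨Set.forall_mem_image.2 fun l _ => rePred_mem_lang l, A.toLearner hA hf,
    Set.forall_mem_image.2 fun l hl T hT => ?_⟩
  obtain ⟨r, hr, hconv⟩ := exists_eventually_recorded_eq (hS hl) hT
  exact ⟨(hpath T).usesFinitelyManyStates_toLearner hA hf (finite_range_of_eventually_eq hconv), _,
    ((hpath T).computes_toLearner hA hf).isLearningSeq, hδ f hfl l hl T hT,
    ex_announce hconv ((hfl r).trans (hr.trans hT.symm))⟩

theorem image_oddLists_mem_noRestriction (hφ : IsAcceptable φ) :
    lang '' oddLists ∈ TxtBMSStarEx φ NoRestriction :=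
  image_lang_mem_txtBMSStarEx hφ subset_rfl fun _ _ _ _ _ _ => trivial

theorem image_shortOddLists_mem_mon (hφ : IsAcceptable φ) :
    lang '' shortOddLists ∈ TxtBMSStarEx φ Mon := by
  refine image_lang_mem_txtBMSStarEx hφ (fun l hl => hl.2) fun f hf l ⟨hlength, hl⟩ T hT => ?_
  rintro s t hst a b ha hb x ⟨hxa, hx⟩
  refine ⟨?_, hx⟩
  obtain rfl := apply_eq_of_announce_eq_some ha
  obtain rfl := apply_eq_of_announce_eq_some hb
  rw [hf] at hxa ⊢
  rcases (recorded T t).eq_nil_or_concat with hnil | ⟨_, n, hn⟩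
  · rwa [hnil, ← List.subset_nil.1 (hnil ▸ recorded_subset_of_le hst)]
  · have hmem : n ∈ recorded T t := by simp [hn]
    obtain ⟨m, rfl⟩ := List.length_eq_one_iff.1 (hlength.antisymm
      (List.length_pos_of_mem (recorded_subset hl hT hmem)))
    obtain rfl := List.mem_singleton.1 (recorded_subset hl hT hmem)
    rwa [lang_congr fun k => ⟨fun hk => recorded_subset hl hT hk,
      fun hk => List.mem_singleton.1 hk ▸ hmem⟩, ← hT]

theorem initSeg_eq_initSeg_iff : initSeg T t = initSeg T' t ↔ ∀ i < t, T i = T' i := by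
  simp [initSeg]

theorem BMSLearner.IsLearningSeq.apply_eq {M : BMSLearner} {h h' : ℕ → Hyp}
    (hh : M.IsLearningSeq T h) (hh' : M.IsLearningSeq T' h') (heq : ∀ i < t, T i = T' i) :
    h t = h' t :=
  Part.some_inj.1 ((hh t).symm.trans (initSeg_eq_initSeg_iff.2 heq ▸ hh' t))

theorem seqContent_initSeg_subset (T : ℕ → Datum) (t : ℕ) :
    seqContent (initSeg T t) ⊆ content T :=
  fun _ hn => mem_content_iff.2 ⟨t, hn⟩

theorem exists_isText_of_seqContent_subset (h : seqContent (initSeg T t) ⊆ L) :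
    ∃ T', IsText T' L ∧ ∀ i < t, T i = T' i := by
  obtain ⟨T', hT', heq⟩ := exists_text_extending (initSeg T t) (L := L)
    fun x hx n hn => h (show some n ∈ _ from hn ▸ hx)
  rw [length_initSeg] at heq
  exact ⟨T', hT', initSeg_eq_initSeg_iff.1 heq.symm⟩

theorem exists_odd_forall_lt (w : List Datum) : ∃ n, Odd n ∧ ∀ x ∈ seqContent w, x < n := by
  obtain ⟨k, hk⟩ := ((List.finite_toSet w).preimage (Option.some_injective ℕ).injOn).bddAbove
  exact ⟨2 * k + 1, ⟨k, rfl⟩, fun x hx => by have := hk hx; omega⟩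

theorem seqContent_subset_lang_singleton (hT : IsText T (lang []))
    (hn : ∀ x ∈ seqContent (initSeg T t), x < n) : seqContent (initSeg T t) ⊆ lang [n] := by
  intro x hx
  have hmem : x ∈ lang [] := hT ▸ seqContent_initSeg_subset T t hx
  rw [lang_nil] at hmem
  exact Or.inr (Or.inr ⟨hmem, by simpa using hn x hx⟩)

theorem exists_switch {M : BMSLearner} {δ : Restriction}
    (hM : ∀ l ∈ shortOddLists, ∀ T, IsText T (lang l) →
      ∃ h, M.IsLearningSeq T h ∧ δ (W φ) h T ∧ Ex (W φ) h T) :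
    ∃ n T h s t a b, Odd n ∧ IsText T (lang [n]) ∧ M.IsLearningSeq T h ∧ δ (W φ) h T ∧ s ≤ t ∧
      h s = some a ∧ h t = some b ∧ W φ a = lang [] ∧ W φ b = lang [n] := by
  obtain ⟨T, hT, -⟩ := exists_text_extending (L := lang []) [] (by simp)
  obtain ⟨h, hh, -, s, a, ha, hWa, -⟩ := hM [] (by simp [shortOddLists, oddLists]) T hT
  obtain ⟨n, hn, hlt⟩ := exists_odd_forall_lt (initSeg T s)
  obtain ⟨T', hT', heq⟩ :=
    exists_isText_of_seqContent_subset (seqContent_subset_lang_singleton hT hlt)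
  obtain ⟨h', hh', hδ, t, b, hb, hWb, hconst⟩ :=
    hM [n] (by simp [shortOddLists, oddLists, hn]) T' hT'
  have ha' : h' s = some a := (hh.apply_eq hh' heq).symm.trans ha
  refine ⟨n, T', h', s, max s t, a, b, hn, hT', hh', hδ, le_max_left s t, ha', ?_, hWa.trans hT,
    hWb.trans hT'⟩
  rcases le_total s t with hst | hts
  · rwa [max_eq_right hst]
  · rw [max_eq_left hts, hconst s hts (by simp [ha']), hb]

theorem image_shortOddLists_notMem_sMon :
    lang '' shortOddLists ∉ TxtBMSStarEx φ SMon := by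
  rintro ⟨-, M, hM⟩
  obtain ⟨n, T, h, s, t, a, b, hn, -, -, hSMon, hst, ha, hb, hWa, hWb⟩ :=
    exists_switch fun l hl T hT => (hM _ ⟨l, hl, rfl⟩ T hT).2
  have hsub := hSMon s t hst a b ha hb
  rw [hWa, hWb] at hsub
  exact succ_notMem_lang_singleton n (hsub (succ_mem_lang_nil hn))

theorem image_oddLists_notMem_mon : lang '' oddLists ∉ TxtBMSStarEx φ Mon := by
  rintro ⟨-, M, hM⟩
  obtain ⟨n, T, h, s, t, a, b, hn, hT, hh, -, hst, ha, hb, hWa, hWb⟩ :=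
    exists_switch fun l hl T hT => (hM _ ⟨l, hl.2, rfl⟩ T hT).2
  have hseen : seqContent (initSeg T t) ⊆ lang [n, n + 2] :=
    (hT ▸ seqContent_initSeg_subset T t).trans (lang_singleton_subset n)
  obtain ⟨T', hT', heq⟩ := exists_isText_of_seqContent_subset hseen
  have hodd : [n, n + 2] ∈ oddLists := by simp [oddLists, hn, Nat.odd_add]
  obtain ⟨-, h', hh', hMon, -⟩ := hM _ ⟨_, hodd, rfl⟩ T' hT'
  have hsub := hMon s t hst a b
    ((hh.apply_eq hh' fun i hi => heq i (hi.trans_le hst)).symm.trans ha)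
    ((hh.apply_eq hh' heq).symm.trans hb)
  rw [hWa, hWb, hT'] at hsub
  exact succ_notMem_lang_singleton n
    (hsub ⟨succ_mem_lang_nil hn, Or.inr (Or.inl (by simp))⟩).1

end Separation

end BMSLearning

theorem mainTheorem2 (φ : ℕ → ℕ →. ℕ) (hφ : BMSLearning.IsAcceptable φ) :
    (BMSLearning.TxtBMSStarEx φ BMSLearning.NU =
      BMSLearning.TxtBMSStarEx φ BMSLearning.NoRestriction) ∧
    (BMSLearning.TxtBMSStarEx φ BMSLearning.Dec =
        BMSLearning.TxtBMSStarEx φ BMSLearning.WMon ∧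
      BMSLearning.TxtBMSStarEx φ BMSLearning.WMon =
        BMSLearning.TxtBMSStarEx φ BMSLearning.Caut ∧
      BMSLearning.TxtBMSStarEx φ BMSLearning.Caut =
        BMSLearning.TxtBMSStarEx φ BMSLearning.NoRestriction) ∧
    (BMSLearning.TxtBMSStarEx φ BMSLearning.Mon ⊂
      BMSLearning.TxtBMSStarEx φ BMSLearning.NoRestriction) ∧
    (BMSLearning.TxtBMSStarEx φ BMSLearning.SMon ⊂
      BMSLearning.TxtBMSStarEx φ BMSLearning.Mon) := by
  open BMSLearning in
  have nU : TxtBMSStarEx φ NU = TxtBMSStarEx φ NoRestriction :=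
    txtBMSStarEx_eq_noRestriction hφ fun H => H.dec.nU
  have dec : TxtBMSStarEx φ Dec = TxtBMSStarEx φ NoRestriction :=
    txtBMSStarEx_eq_noRestriction hφ MonOrRefuted.dec
  have wMon : TxtBMSStarEx φ WMon = TxtBMSStarEx φ NoRestriction :=
    txtBMSStarEx_eq_noRestriction hφ MonOrRefuted.wMon
  have caut : TxtBMSStarEx φ Caut = TxtBMSStarEx φ NoRestriction :=
    txtBMSStarEx_eq_noRestriction hφ MonOrRefuted.caut
  exact ⟨nU, ⟨dec.trans wMon.symm, wMon.trans caut.symm, caut⟩,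
    ⟨txtBMSStarEx_subset_noRestriction,
      fun hsub => image_oddLists_notMem_mon (hsub (image_oddLists_mem_noRestriction hφ))⟩,
    ⟨txtBMSStarEx_mono SMon.mon, fun hsub =>
      image_shortOddLists_notMem_sMon (hsub (image_shortOddLists_mem_mon hφ))⟩⟩
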